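/- **Setting.** For unit vectors $v_1,\dots,v_n\in\mathbb R^d$, a one-round protocol consists of a local randomizer $\mathcal R$, which client $i$ applies to $v_i$ with independent randomness, and a server map $\mathcal A$ that outputs the estimate $\mathcal A(\mathcal R(v_1),\dots,\mathcal R(v_n))$ of the mean. The randomizer is $\varepsilon$-DP if $\Pr(\mathcal R(v)\in S)\le e^{\varepsilon}\Pr(\mathcal R(v')\in S)$ for all unit vectors $v,v'$ and all events $S$. Put $$\mathrm{err}_{n,d}(\mathcal A,\mathcal R)=\sup_{\|v_1\|=\dots=\|v_n\|=1}\mathbb E\Big\|\mathcal A(\mathcal R(v_1),\dots,\mathcal R(v_n))-\tfrac1n\sum_{i=1}^n v_i\Big\|_2^2 .$$ **PrivUnitG.** Let $\Phi,\varphi$ be the standard normal distribution function and density, $p\in[0,1]$, $q\in(0,1)$, $\sigma=1/\sqrt d$, $\gamma=\sigma\,\Phi^{-1}(q)$, and $m=\sigma\varphi(\gamma/\sigma)\big(\frac p{1-q}-\frac{1-p}q\big)$, where $m\neq0$. On a unit vector $v\in\mathbb R^d$, $\mathrm{PrivUnitG}(p,q)$ draws $\alpha$, which with probability $p$ is $N(0,\sigma^2)$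 conditioned on being $\ge\gamma$ and with probability $1-p$ is $N(0,\sigma^2)$ conditioned on being $<\gamma$, draws independently $V^\perp\sim N(0,\sigma^2(I-vv^\top))$, and outputs $\frac1m(\alpha v+V^\perp)$; its server averages the messages. Parameters $(p,q)$ are *optimized* for $\varepsilon$ in dimension $d$ if they minimize the expected squared error $\mathrm{err}_{1,d}$ among all $(p,q)$ as above for which $\mathrm{PrivUnitG}(p,q)$ is $\varepsilon$-DP. Write $\mathrm{err}_{n,d}(\mathrm{PrivUnitG})$ for the error of the protocol with parameters optimized in dimension $d$. **Random rotation protocol.** Let $1\le k\le d$. Each client independently samples $W=\sqrt{d/k}\,S\,U\in\mathbb R^{k\times d}$, where $U$ is uniformly distributed (Haar) on the orthogonal group of $\mathbb R^{d\times d}$ and, independently, each row of $S\in\{0,1\}^{k\times d}$ has a single $1$, the positions being uniformly random without repetition. On input $v$ the client (randomizer $\mathcal R$) computes $u=Wv/\|Wv\|_2$ (which is defined with probability one), runs PrivUnitG on $u$ in dimension $k$, with parameters optimized for $\varepsilon$ in dimension $k$, to obtain $\hat u$, and sends $(\hat u,W)$. The server outputs $\hat\mu=\frac1n\sum_{i=1}^n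 W_i^\top\hat u_i$. **Theorem.** For every $\varepsilon>0$ and $d\ge1$ optimized parameters of PrivUnitG exist, and $\mathrm{err}_{n,d}(\mathrm{PrivUnitG})<\infty$ for all $n\ge1$. There is an absolute constant $C>0$ such that for all $\varepsilon>0$, $n\ge1$, $1\le k\le d$ and every choice of optimized parameters, the local randomizer $\mathcal R$ of the random rotation protocol is $\varepsilon$-DP, and for all unit vectors $v_1,\dots,v_n\in\mathbb R^d$ $$\mathbb E\Big\|\hat\mu-\frac1n\sum_{i=1}^n v_i\Big\|_2^2\le \mathrm{err}_{n,d}(\mathrm{PrivUnitG})\Big(1+C\,\frac{\varepsilon+\log k}{k}\Big)+\frac{C}{k^2}.$$ -/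

import Mathlib

open MeasureTheory ProbabilityTheory
open scoped ENNReal NNReal Matrix InnerProductSpace

noncomputable section

/-! ## Matrices and the uniform measure on rotations -/

/-- Real matrices carry the product (equivalently, Borel) sigma-algebra of their entries. -/
instance Matrix.instMeasurableSpaceRealEntries {m n : Type*} :
    MeasurableSpace (Matrix m n ℝ) :=
  inferInstanceAs (MeasurableSpace (m → n → ℝ))

instance Matrix.instBorelSpaceRealEntries {m n : Type*} [Countable m] [Countable n] :
    BorelSpace (Matrix m n ℝ) :=
  inferInstanceAs (BorelSpace (m → n → ℝ))

instance Matrix.instT2SpaceRealEntries {m n : Type*} : T2Space (Matrix m n ℝ) :=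
  inferInstanceAs (T2Space (m → n → ℝ))

theorem Matrix.isCompact_orthogonalGroup (d : ℕ) :
    IsCompact (Matrix.orthogonalGroup (Fin d) ℝ : Set (Matrix (Fin d) (Fin d) ℝ)) := by
  have hK : IsCompact (Set.pi Set.univ fun _ : Fin d =>
      Set.pi Set.univ fun _ : Fin d => Set.Icc (-1 : ℝ) 1) :=
    isCompact_univ_pi fun _ => isCompact_univ_pi fun _ => isCompact_Icc
  refine hK.of_isClosed_subset ?_ ?_
  · have : (Matrix.orthogonalGroup (Fin d) ℝ : Set (Matrix (Fin d) (Fin d) ℝ)) =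
        {A | A * Aᵀ = 1} := by
      ext A
      exact Matrix.mem_orthogonalGroup_iff (Fin d) ℝ
    rw [this]
    exact isClosed_eq (by fun_prop) continuous_const
  · intro A hA i _ j _
    have h := entry_norm_bound_of_unitary hA i j
    rw [Real.norm_eq_abs] at h
    exact abs_le.mp h

instance Matrix.instCompactSpaceOrthogonalGroup (d : ℕ) :
    CompactSpace (Matrix.orthogonalGroup (Fin d) ℝ) :=
  isCompact_iff_compactSpace.mp (Matrix.isCompact_orthogonalGroup d)

/-- The law of a uniformly random rotation `U` (`Uᵀ U = 1`): the Haar measure of total mass one on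
the orthogonal group. -/
def uniformRotation (d : ℕ) : Measure (Matrix.orthogonalGroup (Fin d) ℝ) :=
  Measure.haarMeasure ⊤

instance (d : ℕ) : IsProbabilityMeasure (uniformRotation d) :=
  ⟨Measure.haarMeasure_self⟩

/-- The sampling matrix whose `i`-th row has a single `1`, in column `f i`. -/
def samplingMatrix {k d : ℕ} (f : Fin k ↪ Fin d) : Matrix (Fin k) (Fin d) ℝ :=
  Matrix.of fun i j => if f i = j then 1 else 0

/-- The law of `W = √(d/k) S U`: the locations `f` of the ones of `S` are a uniformly random
sequence of `k` distinct columns, and `U` is an independent uniformly random rotation. -/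
def randomRotationProjection (k d : ℕ) : Measure (Matrix (Fin k) (Fin d) ℝ) :=
  (Fintype.card (Fin k ↪ Fin d) : ℝ≥0∞)⁻¹ • ∑ f : Fin k ↪ Fin d,
    (uniformRotation d).map fun U : Matrix.orthogonalGroup (Fin d) ℝ =>
      Real.sqrt ((d : ℝ) / k) • (samplingMatrix f * (U : Matrix (Fin d) (Fin d) ℝ))

/-! ## Local privacy and squared error of a one-round protocol -/

/-- A local randomizer on unit vectors, given by its output laws `R v`, is `ε`-differentially
private. -/
def IsLocallyDP {d : ℕ} {M : Type*} [MeasurableSpace M] (ε : ℝ)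
    (R : EuclideanSpace ℝ (Fin d) → Measure M) : Prop :=
  ∀ v v' : EuclideanSpace ℝ (Fin d), ‖v‖ = 1 → ‖v'‖ = 1 → ∀ S : Set M, MeasurableSet S →
    R v S ≤ ENNReal.ofReal (Real.exp ε) * R v' S

/-- The expected squared error `𝔼 ‖A(R(v₁), …, R(vₙ)) - (1/n) ∑ vᵢ‖²`, where the `n` clients
randomize independently. -/
def meanSquaredError {n d : ℕ} {M : Type*} [MeasurableSpace M]
    (A : (Fin n → M) → EuclideanSpace ℝ (Fin d)) (R : EuclideanSpace ℝ (Fin d) → Measure M)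
    (v : Fin n → EuclideanSpace ℝ (Fin d)) : ℝ≥0∞ :=
  ∫⁻ y, ENNReal.ofReal (‖A y - (1 / (n : ℝ)) • ∑ i, v i‖ ^ 2) ∂(Measure.pi fun i => R (v i))

/-- The worst-case expected squared error over unit vectors. -/
def worstCaseError {n d : ℕ} {M : Type*} [MeasurableSpace M]
    (A : (Fin n → M) → EuclideanSpace ℝ (Fin d)) (R : EuclideanSpace ℝ (Fin d) → Measure M) :
    ℝ≥0∞ :=
  ⨆ (v : Fin n → EuclideanSpace ℝ (Fin d)) (_ : ∀ i, ‖v i‖ = 1), meanSquaredError A R v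

/-! ## PrivUnitG -/

/-- The quantile function `Φ⁻¹` of the standard normal distribution (meaningful on `(0, 1)`). -/
def stdNormalQuantile (q : ℝ) : ℝ :=
  sInf {x : ℝ | q ≤ cdf (gaussianReal 0 1) x}

/-- The standard deviation `σ = 1/√d`. -/
def pugSigma (d : ℕ) : ℝ := 1 / Real.sqrt d

/-- The threshold `γ = σ Φ⁻¹(q)`. -/
def pugGamma (d : ℕ) (q : ℝ) : ℝ := pugSigma d * stdNormalQuantile q

/-- The normalization `m = σ φ(γ/σ) (p/(1-q) - (1-p)/q)`. -/
def pugM (d : ℕ) (p q : ℝ) : ℝ :=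
  pugSigma d * gaussianPDFReal 0 1 (pugGamma d q / pugSigma d) * (p / (1 - q) - (1 - p) / q)

/-- The law of `α`: with probability `p` it is `N(0, σ²)` conditioned on `[γ, ∞)`, and with
probability `1 - p` it is `N(0, σ²)` conditioned on `(-∞, γ)`. -/
def pugAlphaLaw (d : ℕ) (p q : ℝ) : Measure ℝ :=
  ENNReal.ofReal p • cond (gaussianReal 0 ((d : ℝ≥0)⁻¹)) (Set.Ici (pugGamma d q)) +
    ENNReal.ofReal (1 - p) • cond (gaussianReal 0 ((d : ℝ≥0)⁻¹)) (Set.Iio (pugGamma d q))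

/-- The randomness of PrivUnitG: `α` and, independently, a standard Gaussian vector `Z`. -/
def pugNoise (d : ℕ) (p q : ℝ) : Measure (ℝ × EuclideanSpace ℝ (Fin d)) :=
  (pugAlphaLaw d p q).prod (stdGaussian (EuclideanSpace ℝ (Fin d)))

/-- The vector `V^⊥ = σ (I - v vᵀ) Z`. For a unit vector `v`, where `I - v vᵀ` is symmetric and
idempotent, it has law `N(0, σ² (I - v vᵀ))`. -/
def pugPerp {d : ℕ} (v Z : EuclideanSpace ℝ (Fin d)) : EuclideanSpace ℝ (Fin d) :=
  pugSigma d • (Z - ⟪v, Z⟫_ℝ • v)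

/-- The output `(1/m) (α v + V^⊥)` of PrivUnitG as a function of its input and its randomness. -/
def pugOutput {d : ℕ} (p q : ℝ) (v : EuclideanSpace ℝ (Fin d))
    (ω : ℝ × EuclideanSpace ℝ (Fin d)) : EuclideanSpace ℝ (Fin d) :=
  (1 / pugM d p q) • (ω.1 • v + pugPerp v ω.2)

/-- The local randomizer `PrivUnitG(p, q)` in dimension `d`. -/
def privUnitG (d : ℕ) (p q : ℝ) (v : EuclideanSpace ℝ (Fin d)) :
    Measure (EuclideanSpace ℝ (Fin d)) :=
  (pugNoise d p q).map (pugOutput p q v)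

/-- The server of PrivUnitG averages the messages. -/
def pugServer {n d : ℕ} (y : Fin n → EuclideanSpace ℝ (Fin d)) : EuclideanSpace ℝ (Fin d) :=
  (1 / (n : ℝ)) • ∑ i, y i

/-- The worst-case expected squared error of the `PrivUnitG(p, q)` protocol with `n` clients in
dimension `d`. -/
def pugError (n d : ℕ) (p q : ℝ) : ℝ≥0∞ :=
  worstCaseError (pugServer (n := n) (d := d)) (privUnitG d p q)

/-- The parameters for which `PrivUnitG(p, q)` is well defined (finite threshold and nonzero
normalization) and `ε`-differentially private. -/
structure PugAdmissible (ε : ℝ) (d : ℕ) (p q : ℝ) : Prop where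
  p_mem : p ∈ Set.Icc (0 : ℝ) 1
  q_mem : q ∈ Set.Ioo (0 : ℝ) 1
  m_ne_zero : pugM d p q ≠ 0
  private_pug : IsLocallyDP ε (privUnitG d p q)

/-- `(p, q)` are optimized parameters for PrivUnitG with privacy `ε` in dimension `d`: they minimize
the expected squared error of the randomizer among all admissible parameters. -/
def PugOptimal (ε : ℝ) (d : ℕ) (p q : ℝ) : Prop :=
  PugAdmissible ε d p q ∧
    ∀ p' q' : ℝ, PugAdmissible ε d p' q' → pugError 1 d p q ≤ pugError 1 d p' q'

/-! ## The random projection protocol -/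

/-- The client: sample `W` from `μW`, let `u = W v / ‖W v‖`, run `PrivUnitG(p, q)` in dimension `k`
on `u`, with fresh randomness, to get `û`, and send `(û, W)`. -/
def projUnitClient {k d : ℕ} (μW : Measure (Matrix (Fin k) (Fin d) ℝ)) (p q : ℝ)
    (v : EuclideanSpace ℝ (Fin d)) :
    Measure (EuclideanSpace ℝ (Fin k) × Matrix (Fin k) (Fin d) ℝ) :=
  (μW.prod (pugNoise k p q)).map fun x =>
    (pugOutput p q (‖Matrix.toEuclideanLin x.1 v‖⁻¹ • Matrix.toEuclideanLin x.1 v) x.2, x.1)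

/-- The server: `(1/n) ∑ Wᵢᵀ ûᵢ`. -/
def projUnitServer {n k d : ℕ}
    (y : Fin n → EuclideanSpace ℝ (Fin k) × Matrix (Fin k) (Fin d) ℝ) :
    EuclideanSpace ℝ (Fin d) :=
  (1 / (n : ℝ)) • ∑ i, Matrix.toEuclideanLin (y i).2ᵀ (y i).1

end

/-!
Write `t = Φ⁻¹(q)` and `M = m / σ`. The law of `α` is the Gaussian `N(0, σ²)` reweighted by
`A = p / (1 - q)` above the threshold `γ = σ t` and by `B = (1 - p) / q` below it, and
`M = φ(t) (A - B)`. Two facts follow.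

* *Privacy.* The law of PrivUnitG is a rescaled `N(0, σ² I)`, reweighted in the same way according
  to `⟪v, y⟫` (`privUnitG_apply`), so that `ε`-privacy amounts to `A ≤ e ^ ε B` and `B ≤ e ^ ε A`
  (`PugRatio`). Necessity is seen on the inputs `v` and `-v`. This condition does not involve the
  dimension (`pugAdmissible_cdf_iff`), so the parameters that are optimized in dimension `d` are
  available to the clients in dimension `k`.
* *Error.* PrivUnitG is unbiased and its squared error is `(d + t M) / M² - 1` (`pugLoss`), divided
  by `n` for `n` clients (`pugError_eq`). A minimum exists because `M² / (d + t M)` is continuous on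
  the closed set of private parameters and vanishes as `|t| → ∞` (`exists_max_pugQuotient`).

In the random rotation protocol `W Wᵀ = (d / k) I`, hence `𝔼 ‖Wᵀ û‖² = (d / k) 𝔼 ‖û‖²`, and the
rotation invariance of `W` gives `𝔼 Wᵀ û = c v` with `c = 𝔼 ‖W v‖` (`integral_transpose_projUnit`).
The squared norm of `W v` has mean one, and its variance is at most `2 / k` because the fourth
moments of a uniformly random unit vector are determined by its symmetries; hence
`1 - 1 / k ≤ c ≤ 1` (`integral_norm_randomRotationProjection_mem`). The squared bias is thus at most
`1 / k²`, and the variance of a message is at most, with the parameters `(t, p)` optimized in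
dimension `d`,
`(d / k) (k + t M) / M² - c² = pugLoss d t p + (d / k - 1) t / M + (1 - c²)`.
Privacy bounds the two last terms: `t M ≤ 72 ε` and `M² ≤ 512 (1 + ε)` (`mul_pugMean_le_of_ratio`,
`pugMean_sq_le_of_ratio`, from the Mills bound `gaussianPDFReal_le_mul_tail` and `A ≤ e ^ ε`), while
the loss is at least `(d - 1) / M²` because `α` has nonnegative variance. This is
`variance_le_pugLoss`.
-/

open Filter Topology

/-! ### The standard normal distribution on the line -/

lemma gaussianPDFReal_zero_one (x : ℝ) :
    gaussianPDFReal 0 1 x = (√(2 * Real.pi))⁻¹ * Real.exp (-(x ^ 2) / 2) := by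
  simp [gaussianPDFReal]

lemma gaussianPDFReal_zero_one_neg (x : ℝ) : gaussianPDFReal 0 1 (-x) = gaussianPDFReal 0 1 x := by
  simp [gaussianPDFReal_zero_one]

lemma gaussianPDFReal_zero_one_le (x : ℝ) :
    gaussianPDFReal 0 1 x ≤ Real.exp (-(x ^ 2) / 2) / 2 := by
  have h : 2 ≤ √(2 * Real.pi) := by
    apply Real.le_sqrt_of_sq_le
    nlinarith [Real.pi_gt_three]
  rw [gaussianPDFReal_zero_one, div_eq_inv_mul (Real.exp _)]
  exact mul_le_mul_of_nonneg_right (inv_anti₀ two_pos h) (Real.exp_pos _).le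

lemma hasDerivAt_gaussianPDFReal_zero_one (x : ℝ) :
    HasDerivAt (gaussianPDFReal 0 1) (-(x * gaussianPDFReal 0 1 x)) x := by
  have h1 : HasDerivAt (fun x : ℝ => -(x ^ 2) / 2) (-x) x := by
    have : HasDerivAt (fun x : ℝ => -(x ^ 2) / 2) (-((2 : ℕ) * x ^ (2 - 1)) / 2) x :=
      ((hasDerivAt_pow 2 x).fun_neg).div_const 2
    convert this using 1
    norm_num
    ring
  have := (h1.exp).const_mul (√(2 * Real.pi))⁻¹
  have e : gaussianPDFReal 0 1 =
      fun x => (√(2 * Real.pi))⁻¹ * Real.exp (-(x ^ 2) / 2) := by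
    ext x; exact gaussianPDFReal_zero_one x
  rw [e]
  refine this.congr_deriv ?_
  ring

lemma continuous_gaussianPDFReal_zero_one : Continuous (gaussianPDFReal 0 1) :=
  continuous_iff_continuousAt.2 fun x => (hasDerivAt_gaussianPDFReal_zero_one x).continuousAt

instance nullSingletonClass_gaussianReal_zero_one : NullSingletonClass (gaussianReal 0 1) :=
  nullSingletonClass_gaussianReal one_ne_zero

lemma integrable_sq_mul_gaussianPDFReal :
    Integrable (fun x => x ^ 2 * gaussianPDFReal 0 1 x) := by
  have := integrable_rpow_mul_exp_neg_mul_sq (b := 1 / 2) (by norm_num) (s := 2) (by norm_num)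
  refine (this.const_mul (√(2 * Real.pi))⁻¹).congr (ae_of_all _ fun x => ?_)
  simp only [gaussianPDFReal_zero_one]
  rw [show -(1 / 2 : ℝ) * x ^ 2 = -(x ^ 2) / 2 by ring]
  norm_cast
  ring

lemma integrable_id_mul_gaussianPDFReal :
    Integrable (fun x => x * gaussianPDFReal 0 1 x) := by
  have := integrable_mul_exp_neg_mul_sq (b := 1 / 2) (by norm_num)
  refine (this.const_mul (√(2 * Real.pi))⁻¹).congr (ae_of_all _ fun x => ?_)
  simp only [gaussianPDFReal_zero_one]
  rw [show -(1 / 2 : ℝ) * x ^ 2 = -(x ^ 2) / 2 by ring]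
  ring

lemma tendsto_mul_gaussianPDFReal_atTop :
    Tendsto (fun x => x * gaussianPDFReal 0 1 x) atTop (𝓝 0) := by
  have h := tendsto_rpow_abs_mul_exp_neg_mul_sq_cocompact (a := 1 / 2) (by norm_num) 1
  have h2 := (h.mono_left atTop_le_cocompact).const_mul (√(2 * Real.pi))⁻¹
  rw [mul_zero] at h2
  refine h2.congr' ?_
  filter_upwards [eventually_ge_atTop 0] with x hx
  rw [gaussianPDFReal_zero_one, Real.rpow_one, abs_of_nonneg hx,
    show -(1 / 2 : ℝ) * x ^ 2 = -(x ^ 2) / 2 by ring]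
  ring

lemma tendsto_gaussianPDFReal_atTop :
    Tendsto (gaussianPDFReal 0 1) atTop (𝓝 0) := by
  refine tendsto_of_tendsto_of_tendsto_of_le_of_le' tendsto_const_nhds
    tendsto_mul_gaussianPDFReal_atTop
    (Eventually.of_forall fun x => gaussianPDFReal_nonneg _ _ x) ?_
  filter_upwards [eventually_ge_atTop 1] with x hx
  exact le_mul_of_one_le_left (gaussianPDFReal_nonneg _ _ x) hx

lemma setIntegral_gaussianReal_zero_one (s : Set ℝ) (hs : MeasurableSet s) (g : ℝ → ℝ) :
    ∫ x in s, g x ∂(gaussianReal 0 1) = ∫ x in s, g x * gaussianPDFReal 0 1 x := by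
  rw [← integral_indicator hs, integral_gaussianReal_eq_integral_smul one_ne_zero,
    ← integral_indicator hs]
  congr 1
  ext x
  by_cases h : x ∈ s <;> simp [h, mul_comm]

lemma setIntegral_Ici_id_gaussianReal (t : ℝ) :
    ∫ x in Set.Ici t, x ∂(gaussianReal 0 1) = gaussianPDFReal 0 1 t := by
  rw [setIntegral_gaussianReal_zero_one _ measurableSet_Ici, integral_Ici_eq_integral_Ioi]
  have := integral_Ioi_of_hasDerivAt_of_tendsto' (a := t) (f := fun x => -gaussianPDFReal 0 1 x)
    (f' := fun x => x * gaussianPDFReal 0 1 x) (m := -0)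
    (fun x _ => by simpa using (hasDerivAt_gaussianPDFReal_zero_one x).fun_neg)
    integrable_id_mul_gaussianPDFReal.integrableOn tendsto_gaussianPDFReal_atTop.neg
  rw [this]; simp

lemma cdf_gaussianReal_zero_one (t : ℝ) :
    cdf (gaussianReal 0 1) t = (gaussianReal 0 1).real (Set.Iio t) := by
  rw [cdf_eq_real]
  exact measureReal_congr Iio_ae_eq_Iic.symm

lemma real_Ici_gaussianReal (t : ℝ) :
    (gaussianReal 0 1).real (Set.Ici t) = 1 - cdf (gaussianReal 0 1) t := by
  rw [cdf_gaussianReal_zero_one, ← Set.compl_Iio, probReal_compl_eq_one_sub measurableSet_Iio]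

lemma setIntegral_Ici_sq_gaussianReal (t : ℝ) :
    ∫ x in Set.Ici t, x ^ 2 ∂(gaussianReal 0 1) =
      t * gaussianPDFReal 0 1 t + (1 - cdf (gaussianReal 0 1) t) := by
  have h0 : 1 - cdf (gaussianReal 0 1) t = ∫ x in Set.Ioi t, gaussianPDFReal 0 1 x := by
    rw [← real_Ici_gaussianReal, measureReal_def, gaussianReal_apply_eq_integral _ one_ne_zero,
      ENNReal.toReal_ofReal (integral_nonneg fun x => gaussianPDFReal_nonneg _ _ x),
      integral_Ici_eq_integral_Ioi]
  rw [setIntegral_gaussianReal_zero_one _ measurableSet_Ici (fun x => x ^ 2),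
    integral_Ici_eq_integral_Ioi, h0]
  have hi : IntegrableOn (fun x => x ^ 2 * gaussianPDFReal 0 1 x) (Set.Ioi t) :=
    integrable_sq_mul_gaussianPDFReal.integrableOn
  have hg : IntegrableOn (gaussianPDFReal 0 1) (Set.Ioi t) :=
    (integrable_gaussianPDFReal 0 1).integrableOn
  have := integral_Ioi_of_hasDerivAt_of_tendsto' (a := t)
    (f := fun x => -(x * gaussianPDFReal 0 1 x))
    (f' := fun x => x ^ 2 * gaussianPDFReal 0 1 x - gaussianPDFReal 0 1 x) (m := -0)
    (fun x _ => by
      convert ((hasDerivAt_id' x).fun_mul (hasDerivAt_gaussianPDFReal_zero_one x)).fun_neg using 1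
      ring)
    (hi.sub hg) tendsto_mul_gaussianPDFReal_atTop.neg
  rw [integral_sub hi hg] at this
  linarith

lemma integrable_sq_gaussianReal : Integrable (fun x : ℝ => x ^ 2) (gaussianReal 0 1) :=
  (memLp_id_gaussianReal (μ := 0) (v := 1) 2).integrable_sq

lemma integrable_id_gaussianReal : Integrable (fun x : ℝ => x) (gaussianReal 0 1) :=
  (memLp_id_gaussianReal (μ := 0) (v := 1) 1).integrable le_rfl

lemma integral_sq_gaussianReal : ∫ x, x ^ 2 ∂(gaussianReal 0 1) = 1 := by
  have h := variance_fun_id_gaussianReal (μ := 0) (v := 1)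
  rw [variance_of_integral_eq_zero (by fun_prop) integral_id_gaussianReal] at h
  simpa using h

lemma setIntegral_Iio_id_gaussianReal (t : ℝ) :
    ∫ x in Set.Iio t, x ∂(gaussianReal 0 1) = -gaussianPDFReal 0 1 t := by
  have h := integral_add_compl (measurableSet_Iio (a := t)) integrable_id_gaussianReal
  rw [Set.compl_Iio, setIntegral_Ici_id_gaussianReal, integral_id_gaussianReal] at h
  linarith

lemma setIntegral_Iio_sq_gaussianReal (t : ℝ) :
    ∫ x in Set.Iio t, x ^ 2 ∂(gaussianReal 0 1) =
      cdf (gaussianReal 0 1) t - t * gaussianPDFReal 0 1 t := by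
  have h := integral_add_compl (measurableSet_Iio (a := t)) integrable_sq_gaussianReal
  rw [Set.compl_Iio, setIntegral_Ici_sq_gaussianReal, integral_sq_gaussianReal] at h
  linarith

lemma cdf_gaussianReal_sub (s t : ℝ) :
    cdf (gaussianReal 0 1) t - cdf (gaussianReal 0 1) s = ∫ x in s..t, gaussianPDFReal 0 1 x := by
  rw [cdf_eq_real, cdf_eq_real, measureReal_def, measureReal_def,
    gaussianReal_apply_eq_integral _ one_ne_zero, gaussianReal_apply_eq_integral _ one_ne_zero,
    ENNReal.toReal_ofReal (integral_nonneg fun x => gaussianPDFReal_nonneg _ _ x),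
    ENNReal.toReal_ofReal (integral_nonneg fun x => gaussianPDFReal_nonneg _ _ x)]
  exact intervalIntegral.integral_Iic_sub_Iic (integrable_gaussianPDFReal 0 1).integrableOn
    (integrable_gaussianPDFReal 0 1).integrableOn

lemma strictMono_cdf_gaussianReal : StrictMono (cdf (gaussianReal 0 1)) := by
  intro s t hst
  have := cdf_gaussianReal_sub s t
  have h2 : 0 < ∫ x in s..t, gaussianPDFReal 0 1 x :=
    intervalIntegral.intervalIntegral_pos_of_pos
      (integrable_gaussianPDFReal 0 1).intervalIntegrable
      (fun x => gaussianPDFReal_pos 0 1 x one_ne_zero) hst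
  linarith

lemma continuous_cdf_gaussianReal : Continuous (cdf (gaussianReal 0 1)) := by
  have : (cdf (gaussianReal 0 1) : ℝ → ℝ) = fun t =>
      cdf (gaussianReal 0 1) 0 + ∫ x in (0 : ℝ)..t, gaussianPDFReal 0 1 x := by
    ext t
    rw [← cdf_gaussianReal_sub 0 t]; ring
  rw [this]
  exact continuous_const.add (intervalIntegral.continuous_primitive
    (fun a b => (integrable_gaussianPDFReal 0 1).intervalIntegrable) 0)

lemma cdf_gaussianReal_pos (t : ℝ) : 0 < cdf (gaussianReal 0 1) t :=
  (cdf_nonneg _ (t - 1)).trans_lt (strictMono_cdf_gaussianReal (by linarith))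

lemma cdf_gaussianReal_lt_one (t : ℝ) : cdf (gaussianReal 0 1) t < 1 :=
  (strictMono_cdf_gaussianReal (lt_add_one t)).trans_le (cdf_le_one _ _)

lemma cdf_gaussianReal_neg (t : ℝ) :
    cdf (gaussianReal 0 1) (-t) = 1 - cdf (gaussianReal 0 1) t := by
  rw [← real_Ici_gaussianReal, cdf_eq_real, measureReal_def, measureReal_def]
  conv_rhs => rw [← neg_zero (G := ℝ), ← gaussianReal_map_neg,
    Measure.map_apply measurable_neg measurableSet_Ici]
  congr 2
  ext x
  simp

lemma cdf_gaussianReal_zero : cdf (gaussianReal 0 1) 0 = 1 / 2 := by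
  have := cdf_gaussianReal_neg 0
  rw [neg_zero] at this
  linarith

lemma stdNormalQuantile_cdf (t : ℝ) : stdNormalQuantile (cdf (gaussianReal 0 1) t) = t := by
  have : {x : ℝ | cdf (gaussianReal 0 1) t ≤ cdf (gaussianReal 0 1) x} = Set.Ici t := by
    ext x
    exact strictMono_cdf_gaussianReal.le_iff_le
  rw [stdNormalQuantile, this, csInf_Ici]

lemma cdf_stdNormalQuantile {q : ℝ} (hq : q ∈ Set.Ioo (0 : ℝ) 1) :
    cdf (gaussianReal 0 1) (stdNormalQuantile q) = q := by
  obtain ⟨a, ha⟩ := ((tendsto_cdf_atBot (gaussianReal 0 1)).eventually_lt_const hq.1).exists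
  obtain ⟨b, hb⟩ := ((tendsto_cdf_atTop (gaussianReal 0 1)).eventually_const_lt hq.2).exists
  obtain ⟨t, rfl⟩ := mem_range_of_exists_le_of_exists_ge continuous_cdf_gaussianReal
    ⟨a, ha.le⟩ ⟨b, hb.le⟩
  rw [stdNormalQuantile_cdf]

/-- A lower bound of Mills type for the upper tail: on `[t, t + 1 / (t + 1)]` the density stays
above `e ^ (-3 / 2) ≥ 1 / 8` times its value at `t`. -/
lemma gaussianPDFReal_le_mul_tail {t : ℝ} (ht : 0 ≤ t) :
    gaussianPDFReal 0 1 t ≤ 8 * (t + 1) * (1 - cdf (gaussianReal 0 1) t) := by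
  set h := 1 / (t + 1) with hh
  have ht1 : 0 < t + 1 := by linarith
  have hpos : 0 < h := by positivity
  have hth : t * h ≤ 1 := by rw [hh, mul_one_div, div_le_one ht1]; linarith
  have hh1 : h ≤ 1 := by rw [hh, div_le_one ht1]; linarith
  have hexp : Real.exp (3 / 2) ≤ 8 := by
    have h3 : Real.exp (3 / 2) ≤ Real.exp 1 ^ 2 := by
      rw [← Real.exp_nat_mul]; gcongr; norm_num
    have := Real.exp_one_lt_d9
    nlinarith [Real.exp_pos 1]
  have hlow : ∀ x ∈ Set.Icc t (t + h), gaussianPDFReal 0 1 t / 8 ≤ gaussianPDFReal 0 1 x := by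
    intro x hx
    rw [div_le_iff₀ (by norm_num)]
    refine le_trans ?_ (mul_le_mul_of_nonneg_left hexp (gaussianPDFReal_nonneg _ _ x))
    rw [gaussianPDFReal_zero_one, gaussianPDFReal_zero_one, mul_assoc, ← Real.exp_add]
    gcongr
    have h1 : x ^ 2 ≤ (t + h) ^ 2 := by
      have := hx.1
      exact pow_le_pow_left₀ (by linarith) hx.2 2
    nlinarith
  have h2 : h * (gaussianPDFReal 0 1 t / 8) ≤
      cdf (gaussianReal 0 1) (t + h) - cdf (gaussianReal 0 1) t := by
    rw [cdf_gaussianReal_sub]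
    have := intervalIntegral.integral_mono_on (a := t) (b := t + h) (μ := volume)
      (f := fun _ => gaussianPDFReal 0 1 t / 8)
      (g := gaussianPDFReal 0 1) (by linarith) intervalIntegrable_const
      (integrable_gaussianPDFReal 0 1).intervalIntegrable hlow
    rw [intervalIntegral.integral_const, smul_eq_mul, add_sub_cancel_left] at this
    exact this
  have h3 := (cdf_gaussianReal_lt_one (t + h)).le
  have h4 : h * (gaussianPDFReal 0 1 t / 8) ≤ 1 - cdf (gaussianReal 0 1) t := by linarith
  have h5 : h * (t + 1) = 1 := by rw [hh]; field_simp
  calc gaussianPDFReal 0 1 t = 8 * (t + 1) * (h * (gaussianPDFReal 0 1 t / 8)) := by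
        linear_combination (-gaussianPDFReal 0 1 t) * h5
    _ ≤ _ := by gcongr

/-! ### The law of `α` and its moments -/

/-- The quantity `m / σ` of PrivUnitG with `q = Φ(t)`, which does not depend on the dimension. -/
noncomputable def pugMean (t p : ℝ) : ℝ :=
  gaussianPDFReal 0 1 t *
    (p / (1 - cdf (gaussianReal 0 1) t) - (1 - p) / cdf (gaussianReal 0 1) t)

lemma pugSigma_pos {d : ℕ} (hd : 1 ≤ d) : 0 < pugSigma d := by
  unfold pugSigma; positivity

lemma pugSigma_sq (d : ℕ) : pugSigma d ^ 2 = (d : ℝ)⁻¹ := by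
  rw [pugSigma, div_pow, Real.sq_sqrt (Nat.cast_nonneg _), one_pow, one_div]

lemma pugGamma_cdf (d : ℕ) (t : ℝ) :
    pugGamma d (cdf (gaussianReal 0 1) t) = pugSigma d * t := by
  rw [pugGamma, stdNormalQuantile_cdf]

lemma pugM_cdf {d : ℕ} (hd : 1 ≤ d) (p t : ℝ) :
    pugM d p (cdf (gaussianReal 0 1) t) = pugSigma d * pugMean t p := by
  rw [pugM, pugGamma_cdf, mul_div_cancel_left₀ _ (pugSigma_pos hd).ne', pugMean, mul_assoc]

/-- The weights `p / (1 - q)` and `(1 - p) / q` of the two half lines average to one. -/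
lemma cdf_weights_sum (t p : ℝ) :
    p / (1 - cdf (gaussianReal 0 1) t) * (1 - cdf (gaussianReal 0 1) t) +
      (1 - p) / cdf (gaussianReal 0 1) t * cdf (gaussianReal 0 1) t = 1 := by
  have h1 := cdf_gaussianReal_pos t
  have h2 := cdf_gaussianReal_lt_one t
  rw [div_mul_cancel₀ _ (by linarith), div_mul_cancel₀ _ h1.ne']
  ring

lemma gaussianReal_inv_natCast (d : ℕ) :
    gaussianReal 0 ((d : ℝ≥0)⁻¹) = (gaussianReal 0 1).map (pugSigma d * ·) := by
  rw [gaussianReal_map_const_mul]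
  congr 1
  · simp
  · ext
    simp [pugSigma_sq]

lemma preimage_const_mul_Ici_mul {c : ℝ} (hc : 0 < c) (t : ℝ) :
    (c * ·) ⁻¹' Set.Ici (c * t) = Set.Ici t := by
  ext x; simp [mul_le_mul_iff_right₀ hc]

lemma preimage_const_mul_Iio_mul {c : ℝ} (hc : 0 < c) (t : ℝ) :
    (c * ·) ⁻¹' Set.Iio (c * t) = Set.Iio t := by
  ext x; simp [mul_lt_mul_iff_right₀ hc]

lemma gaussianReal_Ici (t : ℝ) :
    gaussianReal 0 1 (Set.Ici t) = ENNReal.ofReal (1 - cdf (gaussianReal 0 1) t) := by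
  rw [← real_Ici_gaussianReal, ofReal_measureReal]

lemma gaussianReal_Iio (t : ℝ) :
    gaussianReal 0 1 (Set.Iio t) = ENNReal.ofReal (cdf (gaussianReal 0 1) t) := by
  rw [cdf_gaussianReal_zero_one, ofReal_measureReal]

lemma pugAlphaLaw_eq {d : ℕ} (hd : 1 ≤ d) (p t : ℝ) :
    pugAlphaLaw d p (cdf (gaussianReal 0 1) t) =
      ENNReal.ofReal (p / (1 - cdf (gaussianReal 0 1) t)) •
        (gaussianReal 0 ((d : ℝ≥0)⁻¹)).restrict (Set.Ici (pugSigma d * t)) +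
      ENNReal.ofReal ((1 - p) / cdf (gaussianReal 0 1) t) •
        (gaussianReal 0 ((d : ℝ≥0)⁻¹)).restrict (Set.Iio (pugSigma d * t)) := by
  have h2 := cdf_gaussianReal_lt_one t
  have hm : Measurable (pugSigma d * ·) := measurable_const_mul _
  rw [pugAlphaLaw, pugGamma_cdf, ProbabilityTheory.cond, ProbabilityTheory.cond, smul_smul,
    smul_smul, gaussianReal_inv_natCast,
    Measure.map_apply hm measurableSet_Ici, Measure.map_apply hm measurableSet_Iio,
    preimage_const_mul_Ici_mul (pugSigma_pos hd), preimage_const_mul_Iio_mul (pugSigma_pos hd),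
    gaussianReal_Ici, gaussianReal_Iio, ENNReal.ofReal_div_of_pos (by linarith),
    ENNReal.ofReal_div_of_pos (cdf_gaussianReal_pos t), div_eq_mul_inv, div_eq_mul_inv]

/-- The law of `α` is the Gaussian law reweighted by `p / (1 - q)` above the threshold and by
`(1 - p) / q` below it. -/
lemma pugAlphaLaw_eq_withDensity {d : ℕ} (hd : 1 ≤ d) (p t : ℝ) :
    pugAlphaLaw d p (cdf (gaussianReal 0 1) t) =
      (gaussianReal 0 ((d : ℝ≥0)⁻¹)).withDensity fun x =>
        if pugSigma d * t ≤ x then ENNReal.ofReal (p / (1 - cdf (gaussianReal 0 1) t))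
        else ENNReal.ofReal ((1 - p) / cdf (gaussianReal 0 1) t) := by
  have e : (fun x : ℝ =>
      if pugSigma d * t ≤ x then ENNReal.ofReal (p / (1 - cdf (gaussianReal 0 1) t))
        else ENNReal.ofReal ((1 - p) / cdf (gaussianReal 0 1) t)) =
      (Set.Ici (pugSigma d * t)).indicator
        (fun _ => ENNReal.ofReal (p / (1 - cdf (gaussianReal 0 1) t))) +
      (Set.Iio (pugSigma d * t)).indicator
        (fun _ => ENNReal.ofReal ((1 - p) / cdf (gaussianReal 0 1) t)) := by
    ext x
    by_cases h : pugSigma d * t ≤ x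
    · simp [h, not_lt.2 h]
    · simp [h, not_le.1 h]
  rw [e, withDensity_add_left (measurable_const.indicator measurableSet_Ici),
    withDensity_indicator measurableSet_Ici, withDensity_indicator measurableSet_Iio,
    withDensity_const, withDensity_const, pugAlphaLaw_eq hd]

lemma integrable_pugAlphaLaw {d : ℕ} (hd : 1 ≤ d) (p t : ℝ) {g : ℝ → ℝ}
    (hg : Integrable g (gaussianReal 0 ((d : ℝ≥0)⁻¹))) :
    Integrable g (pugAlphaLaw d p (cdf (gaussianReal 0 1) t)) := by
  rw [pugAlphaLaw_eq hd]
  exact (hg.restrict.smul_measure ENNReal.ofReal_ne_top).add_measure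
    (hg.restrict.smul_measure ENNReal.ofReal_ne_top)

lemma integral_pugAlphaLaw {d : ℕ} (hd : 1 ≤ d) {p : ℝ} (hp : p ∈ Set.Icc (0 : ℝ) 1) (t : ℝ)
    {g : ℝ → ℝ} (hm : Measurable g) (hg : Integrable g (gaussianReal 0 ((d : ℝ≥0)⁻¹))) :
    ∫ x, g x ∂(pugAlphaLaw d p (cdf (gaussianReal 0 1) t)) =
      p / (1 - cdf (gaussianReal 0 1) t) *
        ∫ x in Set.Ici t, g (pugSigma d * x) ∂(gaussianReal 0 1) +
      (1 - p) / cdf (gaussianReal 0 1) t *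
        ∫ x in Set.Iio t, g (pugSigma d * x) ∂(gaussianReal 0 1) := by
  have h1 := cdf_gaussianReal_pos t
  have h2 := cdf_gaussianReal_lt_one t
  have hs : Measurable (pugSigma d * ·) := measurable_const_mul _
  have ha : 0 ≤ p / (1 - cdf (gaussianReal 0 1) t) := div_nonneg hp.1 (by linarith)
  have hb : 0 ≤ (1 - p) / cdf (gaussianReal 0 1) t := div_nonneg (by linarith [hp.2]) h1.le
  rw [pugAlphaLaw_eq hd, integral_add_measure (hg.restrict.smul_measure ENNReal.ofReal_ne_top)
    (hg.restrict.smul_measure ENNReal.ofReal_ne_top), integral_smul_measure,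
    integral_smul_measure, ENNReal.toReal_ofReal ha, ENNReal.toReal_ofReal hb,
    gaussianReal_inv_natCast,
    setIntegral_map measurableSet_Ici hm.aestronglyMeasurable hs.aemeasurable,
    setIntegral_map measurableSet_Iio hm.aestronglyMeasurable hs.aemeasurable,
    preimage_const_mul_Ici_mul (pugSigma_pos hd), preimage_const_mul_Iio_mul (pugSigma_pos hd),
    smul_eq_mul, smul_eq_mul]

lemma integral_id_pugAlphaLaw {d : ℕ} (hd : 1 ≤ d) {p : ℝ} (hp : p ∈ Set.Icc (0 : ℝ) 1) (t : ℝ) :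
    ∫ x, x ∂(pugAlphaLaw d p (cdf (gaussianReal 0 1) t)) = pugSigma d * pugMean t p := by
  rw [integral_pugAlphaLaw hd hp t (g := fun x => x) measurable_id
    ((memLp_id_gaussianReal 1).integrable le_rfl)]
  rw [integral_const_mul _ fun x : ℝ => x, integral_const_mul _ fun x : ℝ => x,
    setIntegral_Ici_id_gaussianReal, setIntegral_Iio_id_gaussianReal, pugMean]
  ring

lemma integral_sq_pugAlphaLaw {d : ℕ} (hd : 1 ≤ d) {p : ℝ} (hp : p ∈ Set.Icc (0 : ℝ) 1) (t : ℝ) :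
    ∫ x, x ^ 2 ∂(pugAlphaLaw d p (cdf (gaussianReal 0 1) t)) =
      pugSigma d ^ 2 * (1 + t * pugMean t p) := by
  rw [integral_pugAlphaLaw hd hp t (g := fun x => x ^ 2) (by fun_prop)
    (memLp_id_gaussianReal 2).integrable_sq]
  simp only [mul_pow, integral_const_mul, setIntegral_Ici_sq_gaussianReal,
    setIntegral_Iio_sq_gaussianReal, pugMean]
  linear_combination (pugSigma d ^ 2) * cdf_weights_sum t p

lemma isProbabilityMeasure_pugAlphaLaw {d : ℕ} (hd : 1 ≤ d) {p : ℝ} (hp : p ∈ Set.Icc (0 : ℝ) 1)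
    (t : ℝ) : IsProbabilityMeasure (pugAlphaLaw d p (cdf (gaussianReal 0 1) t)) := by
  have h1 := cdf_gaussianReal_pos t
  have h2 := cdf_gaussianReal_lt_one t
  have hm : Measurable (pugSigma d * ·) := measurable_const_mul _
  have ha : 0 ≤ p / (1 - cdf (gaussianReal 0 1) t) := div_nonneg hp.1 (by linarith)
  have hb : 0 ≤ (1 - p) / cdf (gaussianReal 0 1) t := div_nonneg (by linarith [hp.2]) h1.le
  constructor
  rw [pugAlphaLaw_eq hd]
  simp only [Measure.coe_add, Measure.coe_smul, Pi.add_apply, Pi.smul_apply, smul_eq_mul,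
    Measure.restrict_apply_univ]
  rw [gaussianReal_inv_natCast,
    Measure.map_apply hm measurableSet_Ici, Measure.map_apply hm measurableSet_Iio,
    preimage_const_mul_Ici_mul (pugSigma_pos hd), preimage_const_mul_Iio_mul (pugSigma_pos hd),
    gaussianReal_Ici, gaussianReal_Iio, ← ENNReal.ofReal_mul ha, ← ENNReal.ofReal_mul hb,
    ← ENNReal.ofReal_add (mul_nonneg ha (by linarith)) (mul_nonneg hb h1.le),
    cdf_weights_sum, ENNReal.ofReal_one]

lemma memLp_id_pugAlphaLaw {d : ℕ} (hd : 1 ≤ d) (p t : ℝ) :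
    MemLp (fun x : ℝ => x) 2 (pugAlphaLaw d p (cdf (gaussianReal 0 1) t)) :=
  (memLp_two_iff_integrable_sq (by fun_prop)).2
    (integrable_pugAlphaLaw hd p t (memLp_id_gaussianReal 2).integrable_sq)

/-- The variance of `α` is nonnegative. -/
lemma pugMean_sq_le {p : ℝ} (hp : p ∈ Set.Icc (0 : ℝ) 1) (t : ℝ) :
    pugMean t p ^ 2 ≤ 1 + t * pugMean t p := by
  have := isProbabilityMeasure_pugAlphaLaw le_rfl hp t
  have h := variance_nonneg (fun x : ℝ => x) (pugAlphaLaw 1 p (cdf (gaussianReal 0 1) t))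
  rw [variance_eq_sub (memLp_id_pugAlphaLaw le_rfl p t)] at h
  simp only [Pi.pow_apply] at h
  rw [integral_sq_pugAlphaLaw le_rfl hp, integral_id_pugAlphaLaw le_rfl hp, mul_pow,
    pugSigma_sq] at h
  simp at h
  linarith

/-! ### Moments of PrivUnitG -/

section Moments

variable {d : ℕ}

lemma memLp_id_stdGaussian :
    MemLp (fun z => z) 2 (stdGaussian (EuclideanSpace ℝ (Fin d))) :=
  IsGaussian.memLp_two_id

lemma integral_inner_sq_stdGaussian (u : EuclideanSpace ℝ (Fin d)) :
    ∫ z, ⟪u, z⟫_ℝ ^ 2 ∂(stdGaussian (EuclideanSpace ℝ (Fin d))) = ‖u‖ ^ 2 := by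
  have h := variance_dual_stdGaussian (E := EuclideanSpace ℝ (Fin d)) (innerSL ℝ u)
  rw [variance_of_integral_eq_zero (by fun_prop) (integral_strongDual_stdGaussian _),
    innerSL_apply_norm] at h
  exact h

lemma integrable_inner_sq_stdGaussian (u : EuclideanSpace ℝ (Fin d)) :
    Integrable (fun z => ⟪u, z⟫_ℝ ^ 2) (stdGaussian (EuclideanSpace ℝ (Fin d))) :=
  (memLp_id_stdGaussian.const_inner u).integrable_sq

lemma integral_norm_sq_stdGaussian :
    ∫ z, ‖z‖ ^ 2 ∂(stdGaussian (EuclideanSpace ℝ (Fin d))) = d := by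
  have h : ∀ z : EuclideanSpace ℝ (Fin d),
      ‖z‖ ^ 2 = ∑ i, ⟪EuclideanSpace.basisFun (Fin d) ℝ i, z⟫_ℝ ^ 2 := fun z =>
    ((EuclideanSpace.basisFun (Fin d) ℝ).sum_sq_inner_right z).symm
  simp_rw [h]
  rw [integral_finsetSum _ fun i _ => integrable_inner_sq_stdGaussian _]
  simp [integral_inner_sq_stdGaussian]

lemma inner_pugPerp {u : EuclideanSpace ℝ (Fin d)} (hu : ‖u‖ = 1) (z : EuclideanSpace ℝ (Fin d)) :
    ⟪u, pugPerp u z⟫_ℝ = 0 := by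
  simp [pugPerp, inner_smul_right, inner_sub_right, hu]

lemma norm_pugPerp_sq {u : EuclideanSpace ℝ (Fin d)} (hu : ‖u‖ = 1)
    (z : EuclideanSpace ℝ (Fin d)) :
    ‖pugPerp u z‖ ^ 2 = pugSigma d ^ 2 * (‖z‖ ^ 2 - ⟪u, z⟫_ℝ ^ 2) := by
  rw [pugPerp, norm_smul, mul_pow, Real.norm_eq_abs, sq_abs, norm_sub_sq_real, norm_smul, hu,
    inner_smul_right, real_inner_comm, mul_one, Real.norm_eq_abs, sq_abs]
  ring

lemma norm_smul_add_pugPerp_sq {u : EuclideanSpace ℝ (Fin d)} (hu : ‖u‖ = 1) (a : ℝ)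
    (z : EuclideanSpace ℝ (Fin d)) :
    ‖a • u + pugPerp u z‖ ^ 2 = a ^ 2 + pugSigma d ^ 2 * (‖z‖ ^ 2 - ⟪u, z⟫_ℝ ^ 2) := by
  rw [norm_add_sq_real, inner_smul_left, inner_pugPerp hu, norm_pugPerp_sq hu, norm_smul, hu,
    mul_one, Real.norm_eq_abs, sq_abs]
  simp

/-- The map `Z ↦ V^⊥` as a continuous linear map. -/
noncomputable def pugPerpCLM (u : EuclideanSpace ℝ (Fin d)) :
    EuclideanSpace ℝ (Fin d) →L[ℝ] EuclideanSpace ℝ (Fin d) :=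
  pugSigma d • (ContinuousLinearMap.id ℝ (EuclideanSpace ℝ (Fin d)) - (innerSL ℝ u).smulRight u)

lemma pugPerpCLM_apply (u z : EuclideanSpace ℝ (Fin d)) : pugPerpCLM u z = pugPerp u z := by
  simp [pugPerp, pugPerpCLM]

lemma integrable_pugPerp (u : EuclideanSpace ℝ (Fin d)) :
    Integrable (pugPerp u) (stdGaussian (EuclideanSpace ℝ (Fin d))) := by
  simpa only [pugPerpCLM_apply] using
    (pugPerpCLM u).integrable_comp (memLp_id_stdGaussian.integrable one_le_two)

lemma integral_pugPerp (u : EuclideanSpace ℝ (Fin d)) :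
    ∫ z, pugPerp u z ∂(stdGaussian (EuclideanSpace ℝ (Fin d))) = 0 := by
  have := (pugPerpCLM u).integral_comp_comm
    (memLp_id_stdGaussian (d := d) |>.integrable one_le_two)
  simpa only [pugPerpCLM_apply, integral_id_stdGaussian, map_zero] using this

@[fun_prop]
lemma continuous_pugPerp : Continuous fun x : EuclideanSpace ℝ (Fin d) × EuclideanSpace ℝ (Fin d) =>
    pugPerp x.1 x.2 := by
  unfold pugPerp
  fun_prop

lemma continuous_uncurry_pugOutput (p q : ℝ) :
    Continuous fun x : EuclideanSpace ℝ (Fin d) × (ℝ × EuclideanSpace ℝ (Fin d)) =>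
      pugOutput p q x.1 x.2 := by
  unfold pugOutput pugPerp
  fun_prop

lemma measurable_pugOutput (p q : ℝ) (u : EuclideanSpace ℝ (Fin d)) :
    Measurable (pugOutput p q u) :=
  ((continuous_uncurry_pugOutput p q).comp (by fun_prop : Continuous fun x => (u, x))).measurable

lemma isProbabilityMeasure_pugNoise (hd : 1 ≤ d) {p : ℝ} (hp : p ∈ Set.Icc (0 : ℝ) 1) (t : ℝ) :
    IsProbabilityMeasure (pugNoise d p (cdf (gaussianReal 0 1) t)) := by
  have := isProbabilityMeasure_pugAlphaLaw hd hp t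
  unfold pugNoise
  infer_instance

lemma integrable_norm_pugOutput_sq (hd : 1 ≤ d) {p : ℝ} (hp : p ∈ Set.Icc (0 : ℝ) 1) (t : ℝ)
    {u : EuclideanSpace ℝ (Fin d)} (hu : ‖u‖ = 1) :
    Integrable (fun ω => ‖pugOutput p (cdf (gaussianReal 0 1) t) u ω‖ ^ 2)
      (pugNoise d p (cdf (gaussianReal 0 1) t)) := by
  have := isProbabilityMeasure_pugAlphaLaw hd hp t
  simp only [pugOutput, norm_smul, mul_pow, norm_smul_add_pugPerp_sq hu]
  refine Integrable.const_mul (Integrable.add ?_ (Integrable.const_mul ?_ _)) _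
  · exact (memLp_id_pugAlphaLaw hd p t).integrable_sq.comp_fst _
  · exact Integrable.comp_snd (memLp_id_stdGaussian.integrable_norm_pow two_ne_zero |>.sub
      (integrable_inner_sq_stdGaussian u)) _

lemma integral_norm_pugOutput_sq (hd : 1 ≤ d) {p : ℝ} (hp : p ∈ Set.Icc (0 : ℝ) 1) {t : ℝ}
    (hM : pugMean t p ≠ 0) {u : EuclideanSpace ℝ (Fin d)} (hu : ‖u‖ = 1) :
    ∫ ω, ‖pugOutput p (cdf (gaussianReal 0 1) t) u ω‖ ^ 2
      ∂(pugNoise d p (cdf (gaussianReal 0 1) t)) =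
      (d + t * pugMean t p) / pugMean t p ^ 2 := by
  have := isProbabilityMeasure_pugAlphaLaw hd hp t
  simp only [pugOutput, norm_smul, mul_pow, norm_smul_add_pugPerp_sq hu, pugNoise]
  have h2 : Integrable (fun z => ‖z‖ ^ 2 - ⟪u, z⟫_ℝ ^ 2)
      (stdGaussian (EuclideanSpace ℝ (Fin d))) :=
    memLp_id_stdGaussian.integrable_norm_pow two_ne_zero |>.sub (integrable_inner_sq_stdGaussian u)
  rw [integral_const_mul, integral_add ((memLp_id_pugAlphaLaw hd p t).integrable_sq.comp_fst _)
    ((h2.comp_snd _).const_mul _), integral_const_mul,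
    integral_fun_fst (fun a : ℝ => a ^ 2),
    integral_fun_snd (fun z : EuclideanSpace ℝ (Fin d) => ‖z‖ ^ 2 - ⟪u, z⟫_ℝ ^ 2),
    integral_sub (memLp_id_stdGaussian.integrable_norm_pow two_ne_zero)
      (integrable_inner_sq_stdGaussian u), integral_norm_sq_stdGaussian,
    integral_inner_sq_stdGaussian, integral_sq_pugAlphaLaw hd hp, hu, pugM_cdf hd]
  have hs := (pugSigma_pos hd).ne'
  simp only [probReal_univ, one_smul, Real.norm_eq_abs, sq_abs]
  field_simp
  ring

lemma integral_pugOutput (hd : 1 ≤ d) {p : ℝ} (hp : p ∈ Set.Icc (0 : ℝ) 1) {t : ℝ}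
    (hM : pugMean t p ≠ 0) (u : EuclideanSpace ℝ (Fin d)) :
    ∫ ω, pugOutput p (cdf (gaussianReal 0 1) t) u ω
      ∂(pugNoise d p (cdf (gaussianReal 0 1) t)) = u := by
  have := isProbabilityMeasure_pugAlphaLaw hd hp t
  have h1 : Integrable (fun a : ℝ => a • u) (pugAlphaLaw d p (cdf (gaussianReal 0 1) t)) :=
    ((memLp_id_pugAlphaLaw hd p t).integrable one_le_two).smul_const u
  simp only [pugOutput, pugNoise]
  rw [integral_smul, integral_add (h1.comp_fst _) ((integrable_pugPerp u).comp_snd _),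
    integral_fun_fst (fun a : ℝ => a • u), integral_fun_snd (pugPerp u), integral_smul_const,
    integral_id_pugAlphaLaw hd hp]
  rw [integral_pugPerp, pugM_cdf hd]
  have hs := (pugSigma_pos hd).ne'
  simp only [probReal_univ, one_smul, add_zero, smul_smul]
  rw [one_mul, one_div, inv_mul_cancel₀ (mul_ne_zero hs hM), one_smul]

lemma integrable_pugOutput (hd : 1 ≤ d) {p : ℝ} (hp : p ∈ Set.Icc (0 : ℝ) 1) (t : ℝ)
    (u : EuclideanSpace ℝ (Fin d)) :
    Integrable (pugOutput p (cdf (gaussianReal 0 1) t) u)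
      (pugNoise d p (cdf (gaussianReal 0 1) t)) := by
  have := isProbabilityMeasure_pugAlphaLaw hd hp t
  have h1 : Integrable (fun a : ℝ => a • u) (pugAlphaLaw d p (cdf (gaussianReal 0 1) t)) :=
    ((memLp_id_pugAlphaLaw hd p t).integrable one_le_two).smul_const u
  exact ((h1.comp_fst _).add ((integrable_pugPerp u).comp_snd _)).smul
    (1 / pugM d p (cdf (gaussianReal 0 1) t))

end Moments

/-! ### Bias and variance of an average of independent vectors -/

section Average

variable {d : ℕ} {Ω : Type*} [MeasurableSpace Ω]

lemma memLp_euclidean_apply {P : Measure Ω} {X : Ω → EuclideanSpace ℝ (Fin d)} (hX : MemLp X 2 P)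
    (j : Fin d) : MemLp (fun ω => X ω j) 2 P :=
  (EuclideanSpace.proj (𝕜 := ℝ) j).comp_memLp' hX

lemma integral_euclidean_apply {P : Measure Ω} {X : Ω → EuclideanSpace ℝ (Fin d)}
    (hX : Integrable X P) (j : Fin d) : (∫ ω, X ω ∂P) j = ∫ ω, X ω j ∂P :=
  ((EuclideanSpace.proj (𝕜 := ℝ) j).integral_comp_comm hX).symm

lemma integral_norm_sq_eq_variance_add {P : Measure Ω} [IsProbabilityMeasure P]
    {X : Ω → EuclideanSpace ℝ (Fin d)} (hX : MemLp X 2 P) :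
    ∫ ω, ‖X ω‖ ^ 2 ∂P = ∑ j, Var[fun ω => X ω j; P] + ‖∫ ω, X ω ∂P‖ ^ 2 := by
  simp_rw [EuclideanSpace.real_norm_sq_eq]
  rw [integral_finsetSum _ fun j _ => (memLp_euclidean_apply hX j).integrable_sq,
    ← Finset.sum_add_distrib]
  refine Finset.sum_congr rfl fun j _ => ?_
  rw [variance_eq_sub (memLp_euclidean_apply hX j),
    integral_euclidean_apply (hX.integrable one_le_two)]
  simp

/-- The squared error of an average of independent square integrable vectors is the sum of the
variances divided by `n ^ 2`, plus the squared bias. -/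
lemma lintegral_pi_average_error {n : ℕ} (P : Fin n → Measure Ω)
    [∀ i, IsProbabilityMeasure (P i)] {f : Ω → EuclideanSpace ℝ (Fin d)}
    (hf : ∀ i, MemLp f 2 (P i)) (a : EuclideanSpace ℝ (Fin d)) :
    ∫⁻ y, ENNReal.ofReal (‖(1 / (n : ℝ)) • ∑ i, f (y i) - a‖ ^ 2) ∂(Measure.pi P) =
      ENNReal.ofReal ((1 / (n : ℝ)) ^ 2 * ∑ i, (∫ x, ‖f x‖ ^ 2 ∂(P i) - ‖∫ x, f x ∂(P i)‖ ^ 2) +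
        ‖(1 / (n : ℝ)) • ∑ i, ∫ x, f x ∂(P i) - a‖ ^ 2) := by
  have hfi : ∀ i, MemLp (fun y : Fin n → Ω => f (y i)) 2 (Measure.pi P) := fun i =>
    (hf i).comp_measurePreserving (measurePreserving_eval P i)
  have hsum : MemLp (fun y : Fin n → Ω => (1 / (n : ℝ)) • ∑ i, f (y i)) 2 (Measure.pi P) :=
    (memLp_finsetSum Finset.univ fun i _ => hfi i).const_smul (1 / (n : ℝ))
  have hg : MemLp (fun y : Fin n → Ω => (1 / (n : ℝ)) • ∑ i, f (y i) - a) 2 (Measure.pi P) :=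
    hsum.sub (memLp_const a)
  rw [← ofReal_integral_eq_lintegral_ofReal (hg.integrable_norm_pow two_ne_zero)
    (ae_of_all _ fun y => by positivity), integral_norm_sq_eq_variance_add hg]
  have hmean : ∫ y, ((1 / (n : ℝ)) • ∑ i, f (y i) - a) ∂(Measure.pi P) =
      (1 / (n : ℝ)) • ∑ i, ∫ x, f x ∂(P i) - a := by
    rw [integral_sub (hsum.integrable one_le_two) (integrable_const a), integral_smul,
      integral_finsetSum _ fun i _ => (hfi i).integrable one_le_two]
    simp only [integral_const, probReal_univ, one_smul]
    congr 3
    ext1 i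
    exact integral_comp_eval (hf i).aestronglyMeasurable
  have hvar : ∀ j, Var[fun y : Fin n → Ω => ((1 / (n : ℝ)) • ∑ i, f (y i) - a) j; Measure.pi P] =
      (1 / (n : ℝ)) ^ 2 * ∑ i, Var[fun x => f x j; P i] := by
    intro j
    have e : (fun y : Fin n → Ω => ((1 / (n : ℝ)) • ∑ i, f (y i) - a) j) =
        fun y => 1 / (n : ℝ) * (∑ i, fun y : Fin n → Ω => f (y i) j) y - a j := by
      ext y
      simp
    rw [e, variance_sub_const
      (((memLp_finsetSum' Finset.univ fun i _ => memLp_euclidean_apply (hfi i) j).const_mul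
        _).aestronglyMeasurable), variance_const_mul,
      variance_sum_pi fun i => memLp_euclidean_apply (hf i) j]
  have hvari : ∀ i, ∑ j, Var[fun x => f x j; P i] =
      ∫ x, ‖f x‖ ^ 2 ∂(P i) - ‖∫ x, f x ∂(P i)‖ ^ 2 := fun i => by
    rw [integral_norm_sq_eq_variance_add (hf i)]; ring
  rw [hmean]
  simp_rw [hvar]
  rw [← Finset.mul_sum, Finset.sum_comm]
  simp_rw [hvari]

end Average

/-! ### The error of PrivUnitG -/

lemma isProbabilityMeasure_privUnitG {d : ℕ} (hd : 1 ≤ d) {p : ℝ} (hp : p ∈ Set.Icc (0 : ℝ) 1)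
    (t : ℝ) (v : EuclideanSpace ℝ (Fin d)) :
    IsProbabilityMeasure (privUnitG d p (cdf (gaussianReal 0 1) t) v) := by
  have := isProbabilityMeasure_pugNoise hd hp t
  exact Measure.isProbabilityMeasure_map (measurable_pugOutput _ _ _).aemeasurable

/-- The expected squared error of one PrivUnitG message, in dimension `d` with `q = Φ(t)`. -/
noncomputable def pugLoss (d : ℕ) (t p : ℝ) : ℝ :=
  (d + t * pugMean t p) / pugMean t p ^ 2 - 1

lemma meanSquaredError_privUnitG {n d : ℕ} (hn : 1 ≤ n) (hd : 1 ≤ d) {p : ℝ}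
    (hp : p ∈ Set.Icc (0 : ℝ) 1) {t : ℝ} (hM : pugMean t p ≠ 0)
    {v : Fin n → EuclideanSpace ℝ (Fin d)} (hv : ∀ i, ‖v i‖ = 1) :
    meanSquaredError pugServer (privUnitG d p (cdf (gaussianReal 0 1) t)) v =
      ENNReal.ofReal (pugLoss d t p / n) := by
  have hprob := fun i => isProbabilityMeasure_privUnitG hd hp t (v i)
  have hm := fun i => (measurable_pugOutput p (cdf (gaussianReal 0 1) t) (v i)).aemeasurable
    (μ := pugNoise d p (cdf (gaussianReal 0 1) t))
  have hmem : ∀ i, MemLp (fun x => x) 2 (privUnitG d p (cdf (gaussianReal 0 1) t) (v i)) := by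
    intro i
    refine (memLp_map_measure_iff aestronglyMeasurable_id (hm i)).2 ?_
    exact (memLp_two_iff_integrable_sq_norm
      (measurable_pugOutput _ _ _).aestronglyMeasurable).2
      (integrable_norm_pugOutput_sq hd hp t (hv i))
  have h1 : ∀ i, ∫ x, x ∂(privUnitG d p (cdf (gaussianReal 0 1) t) (v i)) = v i := by
    intro i
    rw [privUnitG, integral_map (f := fun x => x) (hm i) aestronglyMeasurable_id,
      integral_pugOutput hd hp hM]
  have h2 : ∀ i, ∫ x, ‖x‖ ^ 2 ∂(privUnitG d p (cdf (gaussianReal 0 1) t) (v i)) =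
      (d + t * pugMean t p) / pugMean t p ^ 2 := by
    intro i
    rw [privUnitG, integral_map (hm i) (by fun_prop), integral_norm_pugOutput_sq hd hp hM (hv i)]
  unfold meanSquaredError pugServer
  rw [lintegral_pi_average_error _ hmem]
  simp only [h1, h2, hv, pugLoss, sub_self, norm_zero, Finset.sum_const, Finset.card_univ,
    Fintype.card_fin, nsmul_eq_mul]
  congr 1
  have : (n : ℝ) ≠ 0 := by positivity
  field_simp
  ring

lemma pugError_eq {n d : ℕ} (hn : 1 ≤ n) (hd : 1 ≤ d) {p : ℝ} (hp : p ∈ Set.Icc (0 : ℝ) 1) {t : ℝ}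
    (hM : pugMean t p ≠ 0) :
    pugError n d p (cdf (gaussianReal 0 1) t) = ENNReal.ofReal (pugLoss d t p / n) := by
  unfold pugError worstCaseError
  apply le_antisymm
  · exact iSup₂_le fun v hv => (meanSquaredError_privUnitG hn hd hp hM hv).le
  · have hv : ∀ _ : Fin n, ‖EuclideanSpace.single (⟨0, hd⟩ : Fin d) (1 : ℝ)‖ = 1 := by simp
    rw [← meanSquaredError_privUnitG hn hd hp hM hv]
    exact le_iSup₂_of_le _ hv le_rfl

/-! ### Privacy of PrivUnitG -/

/-- The two weights in the density of PrivUnitG differ by a factor of at most `exp ε`. -/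
def PugRatio (ε t p : ℝ) : Prop :=
  p / (1 - cdf (gaussianReal 0 1) t) ≤ Real.exp ε * ((1 - p) / cdf (gaussianReal 0 1) t) ∧
    (1 - p) / cdf (gaussianReal 0 1) t ≤ Real.exp ε * (p / (1 - cdf (gaussianReal 0 1) t))

/-- If `α` has the law `N(0, σ²)`, then `α v + V^⊥` has the law `N(0, σ² I)`. -/
lemma map_prod_gaussianReal_pugPerp {d : ℕ} {v : EuclideanSpace ℝ (Fin d)} (hv : ‖v‖ = 1) :
    ((gaussianReal 0 ((d : ℝ≥0)⁻¹)).prod (stdGaussian (EuclideanSpace ℝ (Fin d)))).map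
        (fun ω => ω.1 • v + pugPerp v ω.2) =
      (stdGaussian (EuclideanSpace ℝ (Fin d))).map (pugSigma d • ·) := by
  have := Measure.isProbabilityMeasure_map
    (μ := (gaussianReal 0 ((d : ℝ≥0)⁻¹)).prod (stdGaussian (EuclideanSpace ℝ (Fin d))))
    (f := fun ω => ω.1 • v + pugPerp v ω.2) (by fun_prop)
  have := Measure.isProbabilityMeasure_map
    (μ := stdGaussian (EuclideanSpace ℝ (Fin d)))
    (f := (pugSigma d • ·)) (by fun_prop)
  apply Measure.ext_of_charFun
  ext ξ
  rw [charFun_map_smul, charFun_stdGaussian, charFun_apply, integral_map (by fun_prop)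
    (by fun_prop)]
  have e : ∀ ω : ℝ × EuclideanSpace ℝ (Fin d),
      Complex.exp (⟪ω.1 • v + pugPerp v ω.2, ξ⟫_ℝ * Complex.I) =
      Complex.exp (⟪ω.1, ⟪v, ξ⟫_ℝ⟫_ℝ * Complex.I) *
        Complex.exp (⟪ω.2, pugPerp v ξ⟫_ℝ * Complex.I) := by
    intro ω
    rw [← Complex.exp_add, ← add_mul, ← Complex.ofReal_add]
    congr 3
    simp only [pugPerp, inner_add_left, inner_smul_left, inner_sub_left, inner_smul_right,
      inner_sub_right, real_inner_comm v ω.2]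
    simp
    ring
  simp_rw [e]
  rw [integral_prod_mul (fun a : ℝ => Complex.exp (⟪a, ⟪v, ξ⟫_ℝ⟫_ℝ * Complex.I))
    (fun z : EuclideanSpace ℝ (Fin d) => Complex.exp (⟪z, pugPerp v ξ⟫_ℝ * Complex.I)),
    ← charFun_apply, ← charFun_apply, charFun_gaussianReal, charFun_stdGaussian, ← Complex.exp_add]
  congr 1
  norm_cast
  rw [norm_pugPerp_sq hv, norm_smul, mul_pow, Real.norm_eq_abs, sq_abs, pugSigma_sq]
  push_cast
  ring

/-- The weight of `x` in the density of the law of `α` with respect to `N(0, σ²)`. -/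
noncomputable def pugWeight (d : ℕ) (t p x : ℝ) : ℝ≥0∞ :=
  if pugSigma d * t ≤ x then ENNReal.ofReal (p / (1 - cdf (gaussianReal 0 1) t))
  else ENNReal.ofReal ((1 - p) / cdf (gaussianReal 0 1) t)

lemma measurable_pugWeight (d : ℕ) (t p : ℝ) : Measurable (pugWeight d t p) :=
  Measurable.ite measurableSet_Ici measurable_const measurable_const

/-- The law of PrivUnitG as an integral against the law `N(0, σ² I)`, which does not depend on the
input. -/
lemma privUnitG_apply {d : ℕ} (hd : 1 ≤ d) (p t : ℝ) {v : EuclideanSpace ℝ (Fin d)} (hv : ‖v‖ = 1)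
    {S : Set (EuclideanSpace ℝ (Fin d))} (hS : MeasurableSet S) :
    privUnitG d p (cdf (gaussianReal 0 1) t) v S =
      ∫⁻ y, pugWeight d t p ⟪v, y⟫_ℝ *
        S.indicator 1 ((1 / pugM d p (cdf (gaussianReal 0 1) t)) • y)
        ∂((stdGaussian (EuclideanSpace ℝ (Fin d))).map (pugSigma d • ·)) := by
  have hw := measurable_pugWeight d t p
  have hi : Measurable (S.indicator (1 : EuclideanSpace ℝ (Fin d) → ℝ≥0∞)) :=
    measurable_one.indicator hS
  have ho := measurable_pugOutput p (cdf (gaussianReal 0 1) t) v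
  rw [← map_prod_gaussianReal_pugPerp hv, lintegral_map (by fun_prop) (by fun_prop),
    ← lintegral_indicator_one hS, privUnitG, lintegral_map hi ho, pugNoise,
    pugAlphaLaw_eq_withDensity hd]
  change ∫⁻ a, _ ∂(((gaussianReal 0 ((d : ℝ≥0)⁻¹)).withDensity (pugWeight d t p)).prod _) = _
  rw [prod_withDensity_left hw, lintegral_withDensity_eq_lintegral_mul _ (by fun_prop)
    (g := fun ω => S.indicator 1 (pugOutput p (cdf (gaussianReal 0 1) t) v ω)) (hi.comp ho)]
  refine lintegral_congr fun ω => ?_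
  have : ⟪v, ω.1 • v + pugPerp v ω.2⟫_ℝ = ω.1 := by
    rw [inner_add_right, inner_pugPerp hv, inner_smul_right, real_inner_self_eq_norm_sq, hv]
    simp
  simp only [Pi.mul_apply, this, pugOutput]

lemma isLocallyDP_privUnitG {ε : ℝ} (hε : 0 ≤ ε) {d : ℕ} (hd : 1 ≤ d) {p t : ℝ}
    (hp : p ∈ Set.Icc (0 : ℝ) 1) (h : PugRatio ε t p) :
    IsLocallyDP ε (privUnitG d p (cdf (gaussianReal 0 1) t)) := by
  have h1 := cdf_gaussianReal_pos t
  have h2 := cdf_gaussianReal_lt_one t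
  have ha : 0 ≤ p / (1 - cdf (gaussianReal 0 1) t) := div_nonneg hp.1 (by linarith)
  have hb : 0 ≤ (1 - p) / cdf (gaussianReal 0 1) t := div_nonneg (by linarith [hp.2]) h1.le
  have he : 1 ≤ Real.exp ε := Real.one_le_exp hε
  have hw : ∀ x y, pugWeight d t p x ≤ ENNReal.ofReal (Real.exp ε) * pugWeight d t p y := by
    intro x y
    unfold pugWeight
    split_ifs <;> rw [← ENNReal.ofReal_mul (Real.exp_pos ε).le] <;> apply ENNReal.ofReal_le_ofReal
    · exact le_mul_of_one_le_left ha he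
    · exact h.1
    · exact h.2
    · exact le_mul_of_one_le_left hb he
  intro v v' hv hv' S hS
  have hi : Measurable (S.indicator (1 : EuclideanSpace ℝ (Fin d) → ℝ≥0∞)) :=
    measurable_one.indicator hS
  have hm := measurable_pugWeight d t p
  rw [privUnitG_apply hd p t hv hS, privUnitG_apply hd p t hv' hS,
    ← lintegral_const_mul _ (by fun_prop)]
  refine lintegral_mono fun y => ?_
  dsimp only
  rw [← mul_assoc]
  gcongr
  exact hw _ _

lemma gaussianReal_inv_natCast_Ioi {d : ℕ} (hd : 1 ≤ d) (t : ℝ) :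
    gaussianReal 0 ((d : ℝ≥0)⁻¹) (Set.Ioi (pugSigma d * t)) =
      ENNReal.ofReal (1 - cdf (gaussianReal 0 1) t) := by
  rw [gaussianReal_inv_natCast, Measure.map_apply (measurable_const_mul _) measurableSet_Ioi,
    ← gaussianReal_Ici, ← measure_congr (Ioi_ae_eq_Ici (μ := gaussianReal 0 1) (a := t))]
  congr 1
  ext x; simp [mul_lt_mul_iff_right₀ (pugSigma_pos hd)]

lemma gaussianReal_inv_natCast_Iio {d : ℕ} (hd : 1 ≤ d) (t : ℝ) :
    gaussianReal 0 ((d : ℝ≥0)⁻¹) (Set.Iio (pugSigma d * t)) =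
      ENNReal.ofReal (cdf (gaussianReal 0 1) t) := by
  rw [gaussianReal_inv_natCast, Measure.map_apply (measurable_const_mul _) measurableSet_Iio,
    preimage_const_mul_Iio_mul (pugSigma_pos hd), gaussianReal_Iio]

/-- The mass of the half line beyond `σ |t|`, where `α` has the weight `p / (1 - q)`. -/
lemma pugAlphaLaw_Ioi {d : ℕ} (hd : 1 ≤ d) (p t : ℝ) :
    pugAlphaLaw d p (cdf (gaussianReal 0 1) t) (Set.Ioi (pugSigma d * |t|)) =
      ENNReal.ofReal (p / (1 - cdf (gaussianReal 0 1) t)) *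
        ENNReal.ofReal (1 - cdf (gaussianReal 0 1) |t|) := by
  have hle : pugSigma d * t ≤ pugSigma d * |t| :=
    mul_le_mul_of_nonneg_left (le_abs_self t) (pugSigma_pos hd).le
  have e1 : Set.Ioi (pugSigma d * |t|) ∩ Set.Ici (pugSigma d * t) = Set.Ioi (pugSigma d * |t|) :=
    Set.inter_eq_left.2 fun x hx => hle.trans (le_of_lt hx)
  have e2 : Set.Ioi (pugSigma d * |t|) ∩ Set.Iio (pugSigma d * t) = ∅ := by
    ext x
    simp only [Set.mem_inter_iff, Set.mem_Ioi, Set.mem_Iio, Set.mem_empty_iff_false, iff_false]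
    intro h
    linarith [h.1, h.2]
  rw [pugAlphaLaw_eq hd]
  simp [Measure.restrict_apply measurableSet_Ioi, e1, e2, gaussianReal_inv_natCast_Ioi hd]

/-- The mass of the half line below `-σ |t|`, where `α` has the weight `(1 - p) / q`. -/
lemma pugAlphaLaw_Iio {d : ℕ} (hd : 1 ≤ d) (p t : ℝ) :
    pugAlphaLaw d p (cdf (gaussianReal 0 1) t) (Set.Iio (-(pugSigma d * |t|))) =
      ENNReal.ofReal ((1 - p) / cdf (gaussianReal 0 1) t) *
        ENNReal.ofReal (1 - cdf (gaussianReal 0 1) |t|) := by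
  have hle : -(pugSigma d * |t|) ≤ pugSigma d * t := by
    rw [← mul_neg]
    exact mul_le_mul_of_nonneg_left (neg_abs_le t) (pugSigma_pos hd).le
  have e1 : Set.Iio (-(pugSigma d * |t|)) ∩ Set.Iio (pugSigma d * t) =
      Set.Iio (-(pugSigma d * |t|)) :=
    Set.inter_eq_left.2 fun x hx => lt_of_lt_of_le hx hle
  have e2 : Set.Iio (-(pugSigma d * |t|)) ∩ Set.Ici (pugSigma d * t) = ∅ := by
    ext x
    simp only [Set.mem_inter_iff, Set.mem_Ici, Set.mem_Iio, Set.mem_empty_iff_false, iff_false]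
    intro h
    linarith [h.1, h.2]
  have e3 : gaussianReal 0 ((d : ℝ≥0)⁻¹) (Set.Iio (-(pugSigma d * |t|))) =
      ENNReal.ofReal (1 - cdf (gaussianReal 0 1) |t|) := by
    rw [← mul_neg, gaussianReal_inv_natCast_Iio hd, cdf_gaussianReal_neg]
  rw [pugAlphaLaw_eq hd]
  simp [Measure.restrict_apply measurableSet_Iio, e1, e2, e3]

/-- Privacy for the pair `v, -v` already forces the two weights to be close: the event that
`α > σ |t|` for the input `v` is the event that `α < -σ |t|` for the input `-v`. -/
lemma pugRatio_of_isLocallyDP {ε : ℝ} {d : ℕ} (hd : 1 ≤ d) {p t : ℝ}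
    (hp : p ∈ Set.Icc (0 : ℝ) 1) (hM : pugMean t p ≠ 0)
    (h : IsLocallyDP ε (privUnitG d p (cdf (gaussianReal 0 1) t))) : PugRatio ε t p := by
  have h1 := cdf_gaussianReal_pos t
  have h2 := cdf_gaussianReal_lt_one t
  have h3 := cdf_gaussianReal_lt_one |t|
  have ha : 0 ≤ p / (1 - cdf (gaussianReal 0 1) t) := div_nonneg hp.1 (by linarith)
  have hb : 0 ≤ (1 - p) / cdf (gaussianReal 0 1) t := div_nonneg (by linarith [hp.2]) h1.le
  have hm : pugM d p (cdf (gaussianReal 0 1) t) ≠ 0 := by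
    rw [pugM_cdf hd]; exact mul_ne_zero (pugSigma_pos hd).ne' hM
  set v : EuclideanSpace ℝ (Fin d) := EuclideanSpace.single (⟨0, hd⟩ : Fin d) (1 : ℝ) with hv0
  have hv : ‖v‖ = 1 := by simp [hv0]
  have hv' : ‖-v‖ = 1 := by rw [norm_neg, hv]
  have key : ∀ (w : EuclideanSpace ℝ (Fin d)) (c : ℝ), ‖w‖ = 1 → ∀ T : Set ℝ, MeasurableSet T →
      privUnitG d p (cdf (gaussianReal 0 1) t) w
        {z | c * ⟪w, pugM d p (cdf (gaussianReal 0 1) t) • z⟫_ℝ ∈ T} =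
      pugAlphaLaw d p (cdf (gaussianReal 0 1) t) {a | c * a ∈ T} := by
    intro w c hw T hT
    have hT' : MeasurableSet {z | c * ⟪w, pugM d p (cdf (gaussianReal 0 1) t) • z⟫_ℝ ∈ T} :=
      (by fun_prop : Measurable fun z : EuclideanSpace ℝ (Fin d) =>
        c * ⟪w, pugM d p (cdf (gaussianReal 0 1) t) • z⟫_ℝ) hT
    rw [privUnitG, Measure.map_apply (measurable_pugOutput _ _ _) hT', pugNoise]
    have e : pugOutput p (cdf (gaussianReal 0 1) t) w ⁻¹'
        {z | c * ⟪w, pugM d p (cdf (gaussianReal 0 1) t) • z⟫_ℝ ∈ T} =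
        {a | c * a ∈ T} ×ˢ Set.univ := by
      ext ω
      have : ⟪w, ω.1 • w + pugPerp w ω.2⟫_ℝ = ω.1 := by
        rw [inner_add_right, inner_pugPerp hw, inner_smul_right, real_inner_self_eq_norm_sq, hw]
        simp
      simp only [Set.mem_preimage, pugOutput, Set.mem_ofPred_eq, smul_smul, mul_one_div_cancel hm,
        one_smul, this, Set.mem_prod, Set.mem_univ, and_true]
    rw [e, Measure.prod_prod, measure_univ, mul_one]
  have kv := key v 1 hv
  have kv' := key (-v) (-1) hv'
  simp only [inner_neg_left, one_mul, neg_mul, neg_neg] at kv kv'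
  have hIoi : {a : ℝ | -a ∈ Set.Ioi (pugSigma d * |t|)} = Set.Iio (-(pugSigma d * |t|)) := by
    ext a; simp [lt_neg]
  have hIio : {a : ℝ | -a ∈ Set.Iio (-(pugSigma d * |t|))} = Set.Ioi (pugSigma d * |t|) := by
    ext a; simp
  have hms : ∀ T : Set ℝ, MeasurableSet T →
      MeasurableSet {z | ⟪v, pugM d p (cdf (gaussianReal 0 1) t) • z⟫_ℝ ∈ T} := fun T hT =>
    (by fun_prop : Measurable fun z : EuclideanSpace ℝ (Fin d) =>
      ⟪v, pugM d p (cdf (gaussianReal 0 1) t) • z⟫_ℝ) hT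
  have cancel : ∀ {x y : ℝ}, 0 ≤ x → 0 ≤ y →
      ENNReal.ofReal x * ENNReal.ofReal (1 - cdf (gaussianReal 0 1) |t|) ≤
        ENNReal.ofReal (Real.exp ε) *
          (ENNReal.ofReal y * ENNReal.ofReal (1 - cdf (gaussianReal 0 1) |t|)) →
      x ≤ Real.exp ε * y := by
    intro x y hx hy hxy
    have he := (Real.exp_pos ε).le
    rw [← ENNReal.ofReal_mul hx, ← ENNReal.ofReal_mul hy, ← ENNReal.ofReal_mul he,
      ENNReal.ofReal_le_ofReal_iff (by have := sub_pos.2 h3; positivity), ← mul_assoc] at hxy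
    exact le_of_mul_le_mul_right hxy (by linarith)
  constructor
  · have := h v (-v) hv hv' _ (hms _ (measurableSet_Ioi (a := pugSigma d * |t|)))
    rw [kv _ measurableSet_Ioi, kv' _ measurableSet_Ioi, hIoi, Set.ofPred_mem_eq,
      pugAlphaLaw_Ioi hd, pugAlphaLaw_Iio hd] at this
    exact cancel ha hb this
  · have := h v (-v) hv hv' _ (hms _ (measurableSet_Iio (a := -(pugSigma d * |t|))))
    rw [kv _ measurableSet_Iio, kv' _ measurableSet_Iio, hIio, Set.ofPred_mem_eq,
      pugAlphaLaw_Ioi hd, pugAlphaLaw_Iio hd] at this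
    exact cancel hb ha this

/-- In every dimension, admissibility is the same condition on `p` and `t = Φ⁻¹(q)`. -/
lemma pugAdmissible_cdf_iff {ε : ℝ} (hε : 0 ≤ ε) {d : ℕ} (hd : 1 ≤ d) {p t : ℝ} :
    PugAdmissible ε d p (cdf (gaussianReal 0 1) t) ↔
      p ∈ Set.Icc (0 : ℝ) 1 ∧ pugMean t p ≠ 0 ∧ PugRatio ε t p := by
  have hm : pugM d p (cdf (gaussianReal 0 1) t) ≠ 0 ↔ pugMean t p ≠ 0 := by
    rw [pugM_cdf hd, mul_ne_zero_iff]
    exact and_iff_right (pugSigma_pos hd).ne'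
  constructor
  · intro h
    exact ⟨h.p_mem, hm.1 h.m_ne_zero,
      pugRatio_of_isLocallyDP hd h.p_mem (hm.1 h.m_ne_zero) h.private_pug⟩
  · rintro ⟨hp, hM, hr⟩
    exact ⟨hp, ⟨cdf_gaussianReal_pos t, cdf_gaussianReal_lt_one t⟩, hm.2 hM,
      isLocallyDP_privUnitG hε hd hp hr⟩

lemma PugAdmissible.exists_cdf {ε : ℝ} {d : ℕ} {p q : ℝ} (h : PugAdmissible ε d p q) :
    ∃ t, cdf (gaussianReal 0 1) t = q :=
  ⟨_, cdf_stdNormalQuantile h.q_mem⟩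

/-! ### Bounds on the loss of PrivUnitG -/

lemma pugMean_neg (t p : ℝ) : pugMean (-t) (1 - p) = -pugMean t p := by
  unfold pugMean
  rw [cdf_gaussianReal_neg, gaussianPDFReal_zero_one_neg, sub_sub_cancel, sub_sub_cancel]
  ring

lemma PugRatio.neg {ε t p : ℝ} (h : PugRatio ε t p) : PugRatio ε (-t) (1 - p) := by
  unfold PugRatio at *
  rw [cdf_gaussianReal_neg, sub_sub_cancel, sub_sub_cancel]
  exact h.symm

lemma one_sub_mem_Icc {p : ℝ} (hp : p ∈ Set.Icc (0 : ℝ) 1) : 1 - p ∈ Set.Icc (0 : ℝ) 1 :=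
  ⟨by linarith [hp.2], by linarith [hp.1]⟩

lemma exp_neg_le_one_div {x : ℝ} (hx : 0 ≤ x) : Real.exp (-x) ≤ 1 / (1 + x) := by
  rw [Real.exp_neg, ← one_div]
  exact one_div_le_one_div_of_le (by linarith) (by linarith [Real.add_one_le_exp x])

/-- When the mean is nonnegative, the privacy constraint bounds both weights: the smaller weight is
at most one, and the larger one at most `exp ε`. -/
lemma PugRatio.weights {ε t p : ℝ} (h : PugRatio ε t p) (hp : p ∈ Set.Icc (0 : ℝ) 1)
    (hM : 0 ≤ pugMean t p) :
    (1 - p) / cdf (gaussianReal 0 1) t ≤ 1 ∧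
      p / (1 - cdf (gaussianReal 0 1) t) ≤ Real.exp ε ∧
      p / (1 - cdf (gaussianReal 0 1) t) * (1 - cdf (gaussianReal 0 1) t) ≤ 1 ∧
      0 ≤ (1 - p) / cdf (gaussianReal 0 1) t ∧
      pugMean t p ≤ gaussianPDFReal 0 1 t * (p / (1 - cdf (gaussianReal 0 1) t)) := by
  have h1 := cdf_gaussianReal_pos t
  have h2 := cdf_gaussianReal_lt_one t
  have hφ := gaussianPDFReal_pos 0 1 t one_ne_zero
  have hs := cdf_weights_sum t p
  have ha : 0 ≤ p / (1 - cdf (gaussianReal 0 1) t) := div_nonneg hp.1 (by linarith)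
  have hb : 0 ≤ (1 - p) / cdf (gaussianReal 0 1) t := div_nonneg (by linarith [hp.2]) h1.le
  unfold pugMean at *
  have hr := h.1
  set A := p / (1 - cdf (gaussianReal 0 1) t)
  set B := (1 - p) / cdf (gaussianReal 0 1) t
  have hAB : 0 ≤ A - B := nonneg_of_mul_nonneg_right hM hφ
  have hB1 : B ≤ 1 := by nlinarith
  refine ⟨hB1, ?_, ?_, hb, ?_⟩
  · exact hr.trans (mul_le_of_le_one_right (Real.exp_pos ε).le hB1)
  · nlinarith
  · exact mul_le_mul_of_nonneg_left (by linarith) hφ.le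

lemma mul_exp_neg_sq_le (t : ℝ) : t * Real.exp (-(t ^ 2) / 2) ≤ 1 := by
  rcases le_total t 0 with ht | ht
  · exact (mul_nonpos_of_nonpos_of_nonneg ht (Real.exp_pos _).le).trans zero_le_one
  · have h := exp_neg_le_one_div (x := t ^ 2 / 2) (by positivity)
    rw [← neg_div] at h
    refine (mul_le_mul_of_nonneg_left h ht).trans ?_
    rw [mul_one_div, div_le_one (by positivity)]
    nlinarith [sq_nonneg (t - 1)]

lemma mul_exp_neg_sq_le' (t : ℝ) : t * Real.exp (-(t ^ 2) / 4) ≤ 1 := by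
  rcases le_total t 0 with ht | ht
  · exact (mul_nonpos_of_nonpos_of_nonneg ht (Real.exp_pos _).le).trans zero_le_one
  · have h := exp_neg_le_one_div (x := t ^ 2 / 4) (by positivity)
    rw [← neg_div] at h
    refine (mul_le_mul_of_nonneg_left h ht).trans ?_
    rw [mul_one_div, div_le_one (by positivity)]
    nlinarith [sq_nonneg (t - 2)]

lemma pugMean_le_of_nonneg_threshold {ε t p : ℝ} (h : PugRatio ε t p) (hp : p ∈ Set.Icc (0 : ℝ) 1)
    (hM : 0 ≤ pugMean t p) (ht : 0 ≤ t) : pugMean t p ≤ 8 * (t + 1) := by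
  obtain ⟨-, -, hAQ, -, hMA⟩ := h.weights hp hM
  have hA : 0 ≤ p / (1 - cdf (gaussianReal 0 1) t) :=
    div_nonneg hp.1 (by linarith [cdf_gaussianReal_lt_one t])
  calc pugMean t p ≤ _ := hMA
    _ ≤ 8 * (t + 1) * (1 - cdf (gaussianReal 0 1) t) *
        (p / (1 - cdf (gaussianReal 0 1) t)) :=
      mul_le_mul_of_nonneg_right (gaussianPDFReal_le_mul_tail ht) hA
    _ = 8 * (t + 1) * (p / (1 - cdf (gaussianReal 0 1) t) * (1 - cdf (gaussianReal 0 1) t)) := by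
      ring
    _ ≤ 8 * (t + 1) * 1 := mul_le_mul_of_nonneg_left hAQ (by linarith)
    _ = _ := mul_one _

lemma pugMean_le_exp {ε t p : ℝ} (h : PugRatio ε t p) (hp : p ∈ Set.Icc (0 : ℝ) 1)
    (hM : 0 ≤ pugMean t p) : pugMean t p ≤ gaussianPDFReal 0 1 t * Real.exp ε := by
  obtain ⟨-, hA, -, -, hMA⟩ := h.weights hp hM
  exact hMA.trans (mul_le_mul_of_nonneg_left hA (gaussianPDFReal_nonneg _ _ _))

lemma pugMean_le_exp_neg {ε t p : ℝ} (h : PugRatio ε t p) (hp : p ∈ Set.Icc (0 : ℝ) 1)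
    (hM : 0 ≤ pugMean t p) (ht : 4 * ε ≤ t ^ 2) : pugMean t p ≤ Real.exp (-(t ^ 2) / 4) := by
  refine (pugMean_le_exp h hp hM).trans ?_
  have h1 := mul_le_mul_of_nonneg_right (gaussianPDFReal_zero_one_le t) (Real.exp_pos ε).le
  have h2 : Real.exp (-(t ^ 2) / 2) * Real.exp ε ≤ Real.exp (-(t ^ 2) / 4) := by
    rw [← Real.exp_add]
    exact Real.exp_le_exp.2 (by linarith)
  have h3 := Real.exp_pos (-(t ^ 2) / 4)
  linarith

lemma pugMean_sq_le_of_nonneg {ε t p : ℝ} (hε : 0 < ε) (h : PugRatio ε t p)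
    (hp : p ∈ Set.Icc (0 : ℝ) 1) (hM : 0 ≤ pugMean t p) :
    pugMean t p ^ 2 ≤ 512 * (1 + ε) := by
  rcases le_total t 0 with ht | ht
  · have h0 : pugMean t p ≤ 1 := by
      obtain ⟨-, -, hAQ, -, hMA⟩ := h.weights hp hM
      have hΦ : cdf (gaussianReal 0 1) t ≤ 1 / 2 :=
        cdf_gaussianReal_zero ▸ strictMono_cdf_gaussianReal.monotone ht
      have hA : 0 ≤ p / (1 - cdf (gaussianReal 0 1) t) := div_nonneg hp.1 (by linarith)
      have hφ : gaussianPDFReal 0 1 t ≤ 1 / 2 := by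
        have h1 := gaussianPDFReal_zero_one_le t
        have h2 : Real.exp (-(t ^ 2) / 2) ≤ 1 := Real.exp_le_one_iff.2 (by nlinarith [sq_nonneg t])
        linarith
      nlinarith [gaussianPDFReal_nonneg 0 1 t]
    nlinarith
  · rcases le_total (t ^ 2) (4 * ε) with h4 | h4
    · have h1 := pugMean_le_of_nonneg_threshold h hp hM ht
      nlinarith [sq_nonneg (t - 1)]
    · have h1 := pugMean_le_exp_neg h hp hM h4
      have h2 : Real.exp (-(t ^ 2) / 4) ≤ 1 := Real.exp_le_one_iff.2 (by nlinarith [sq_nonneg t])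
      nlinarith

lemma mul_pugMean_le_of_nonneg {ε t p : ℝ} (hε : 0 < ε) (h : PugRatio ε t p)
    (hp : p ∈ Set.Icc (0 : ℝ) 1) (hM : 0 ≤ pugMean t p) :
    t * pugMean t p ≤ 72 * ε := by
  rcases le_total t 0 with ht | ht
  · exact (mul_nonpos_of_nonpos_of_nonneg ht hM).trans (by positivity)
  rcases le_total ε 1 with h1 | h1
  · -- For small `ε` the difference of the weights is at most `exp ε - 1 ≤ 2 ε`.
    obtain ⟨hB1, -, -, hB0, -⟩ := h.weights hp hM
    have he : Real.exp ε - 1 ≤ 2 * ε := by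
      have := Real.abs_exp_sub_one_le (x := ε) (by rw [abs_of_pos hε]; exact h1)
      rw [abs_of_pos hε] at this
      exact (le_abs_self _).trans this
    have hM' : pugMean t p ≤ gaussianPDFReal 0 1 t * (2 * ε) := by
      unfold pugMean
      refine mul_le_mul_of_nonneg_left ?_ (gaussianPDFReal_nonneg _ _ _)
      have := h.1
      nlinarith [Real.one_le_exp hε.le]
    have h2 := mul_le_mul_of_nonneg_left hM' ht
    have h3 := mul_le_mul_of_nonneg_left (gaussianPDFReal_zero_one_le t) ht
    nlinarith [mul_exp_neg_sq_le t]
  · rcases le_total (t ^ 2) (4 * ε) with h4 | h4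
    · have h2 := mul_le_mul_of_nonneg_left (pugMean_le_of_nonneg_threshold h hp hM ht) ht
      nlinarith [sq_nonneg (t - 1)]
    · have h2 := mul_le_mul_of_nonneg_left (pugMean_le_exp_neg h hp hM h4) ht
      linarith [mul_exp_neg_sq_le' t]

/-- Private parameters have `m ^ 2 = O((1 + ε) σ ^ 2)`: a mean that exceeds a multiple of the
threshold costs more privacy than `ε`. -/
lemma pugMean_sq_le_of_ratio {ε t p : ℝ} (hε : 0 < ε) (h : PugRatio ε t p)
    (hp : p ∈ Set.Icc (0 : ℝ) 1) : pugMean t p ^ 2 ≤ 512 * (1 + ε) := by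
  rcases le_total 0 (pugMean t p) with hM | hM
  · exact pugMean_sq_le_of_nonneg hε h hp hM
  · have := pugMean_sq_le_of_nonneg hε h.neg (one_sub_mem_Icc hp)
      (by rw [pugMean_neg]; linarith)
    rwa [pugMean_neg, neg_sq] at this

/-- Private parameters have `γ m = O(ε σ ^ 2)`. -/
lemma mul_pugMean_le_of_ratio {ε t p : ℝ} (hε : 0 < ε) (h : PugRatio ε t p)
    (hp : p ∈ Set.Icc (0 : ℝ) 1) : t * pugMean t p ≤ 72 * ε := by
  rcases le_total 0 (pugMean t p) with hM | hM
  · exact mul_pugMean_le_of_nonneg hε h hp hM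
  · have := mul_pugMean_le_of_nonneg hε h.neg (one_sub_mem_Icc hp)
      (by rw [pugMean_neg]; linarith)
    rwa [pugMean_neg, neg_mul_neg] at this

lemma abs_pugMean_le {ε t p : ℝ} (h : PugRatio ε t p) (hp : p ∈ Set.Icc (0 : ℝ) 1) :
    |pugMean t p| ≤ gaussianPDFReal 0 1 t * Real.exp ε := by
  rcases le_total 0 (pugMean t p) with hM | hM
  · rw [abs_of_nonneg hM]
    exact pugMean_le_exp h hp hM
  · have := pugMean_le_exp h.neg (one_sub_mem_Icc hp) (by rw [pugMean_neg]; linarith)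
    rwa [pugMean_neg, gaussianPDFReal_zero_one_neg, ← abs_of_nonpos hM] at this

lemma le_pugLoss {d : ℕ} {p : ℝ} (hp : p ∈ Set.Icc (0 : ℝ) 1) {t : ℝ} (hM : pugMean t p ≠ 0) :
    ((d : ℝ) - 1) / pugMean t p ^ 2 ≤ pugLoss d t p := by
  have h := pugMean_sq_le hp t
  have h0 : 0 < pugMean t p ^ 2 := by positivity
  rw [pugLoss, le_sub_iff_add_le, div_add_one h0.ne']
  exact div_le_div_of_nonneg_right (by linarith) h0.le

lemma pugLoss_nonneg {d : ℕ} (hd : 1 ≤ d) {p : ℝ} (hp : p ∈ Set.Icc (0 : ℝ) 1) {t : ℝ}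
    (hM : pugMean t p ≠ 0) : 0 ≤ pugLoss d t p := by
  have : (1 : ℝ) ≤ d := by exact_mod_cast hd
  exact (div_nonneg (by linarith) (sq_nonneg _)).trans (le_pugLoss hp hM)

/-- The variance `(d / k) 𝔼 ‖û‖² - c²` of one message of the random rotation protocol, compared with
the loss of PrivUnitG in dimension `d`. The constant is `72 + 2048`: the first part pays for
`(d / k - 1) t / M` and the second one, when `k ≥ 2`, for `1 - c² ≤ 2 / k`. -/
lemma variance_le_pugLoss {ε : ℝ} (hε : 0 < ε) {k d : ℕ} (hk : 1 ≤ k) (hkd : k ≤ d) {t p : ℝ}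
    (hp : p ∈ Set.Icc (0 : ℝ) 1) (hM : pugMean t p ≠ 0) (h : PugRatio ε t p) {c : ℝ}
    (hc : 1 - 1 / (k : ℝ) ≤ c) :
    (d : ℝ) / k * (pugLoss k t p + 1) - c ^ 2 ≤
      pugLoss d t p * (1 + 2120 * ((ε + Real.log k) / k)) + 1 / (k : ℝ) ^ 2 := by
  have hk0 : (1 : ℝ) ≤ k := by exact_mod_cast hk
  have hd0 : (k : ℝ) ≤ d := by exact_mod_cast hkd
  have hkpos : (0 : ℝ) < k := by linarith
  have hM0 : 0 < pugMean t p ^ 2 := by positivity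
  have hx := mul_pugMean_le_of_ratio hε h hp
  have hM2 := pugMean_sq_le_of_ratio hε h hp
  have hL := le_pugLoss (d := d) hp hM
  have hL0 := pugLoss_nonneg (hk.trans hkd) hp hM
  have hlog : 0 ≤ Real.log k := Real.log_nonneg hk0
  have hdecomp : (d : ℝ) / k * (pugLoss k t p + 1) - c ^ 2 = pugLoss d t p +
      ((d : ℝ) / k - 1) * (t * pugMean t p / pugMean t p ^ 2) + (1 - c ^ 2) := by
    unfold pugLoss
    field_simp
    ring
  have hfirst : ((d : ℝ) / k - 1) * (t * pugMean t p / pugMean t p ^ 2) ≤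
      pugLoss d t p * (72 * (ε / k)) := by
    have h1 : 0 ≤ (d : ℝ) / k - 1 := by
      rw [sub_nonneg, le_div_iff₀ hkpos]; linarith
    have h2 : (d : ℝ) / k - 1 ≤ (d - 1) / k := by
      rw [sub_div]; gcongr; rw [div_le_one hkpos]; exact hk0
    calc ((d : ℝ) / k - 1) * (t * pugMean t p / pugMean t p ^ 2)
        ≤ ((d : ℝ) / k - 1) * (72 * ε / pugMean t p ^ 2) := by gcongr
      _ ≤ ((d - 1) / k) * (72 * ε / pugMean t p ^ 2) := by gcongr
      _ = (d - 1) / pugMean t p ^ 2 * (72 * (ε / k)) := by ring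
      _ ≤ _ := by gcongr
  have hsecond : 1 - c ^ 2 ≤
      pugLoss d t p * (2048 * ((ε + Real.log k) / k)) + 1 / (k : ℝ) ^ 2 := by
    rcases hk.eq_or_lt with rfl | hk2
    · have : 0 ≤ pugLoss d t p * (2048 * ((ε + Real.log (1 : ℕ)) / (1 : ℕ))) := by positivity
      norm_num at this ⊢
      nlinarith [sq_nonneg c]
    · have hk2' : (2 : ℝ) ≤ k := by exact_mod_cast hk2
      have hinv : 1 / (k : ℝ) ≤ 1 := by rw [div_le_one hkpos]; exact hk0
      have h1 : 1 - c ^ 2 ≤ 2 / k := by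
        have : (1 - 1 / (k : ℝ)) ^ 2 ≤ c ^ 2 := pow_le_pow_left₀ (by linarith) hc 2
        have h3 : 2 / (k : ℝ) = 2 * (1 / k) := by ring
        nlinarith [sq_nonneg (1 / (k : ℝ))]
      -- The loss is at least a multiple of `1 / (1 + ε)`, so a term `2 / k` is affordable.
      have h2 : 1 ≤ pugLoss d t p * (1024 * (ε + Real.log k)) := by
        have h3 : 1 / pugMean t p ^ 2 ≤ pugLoss d t p :=
          le_trans (by gcongr; linarith) hL
        have h4 : 0.69 ≤ Real.log k :=
          le_trans (by linarith [Real.log_two_gt_d9]) (Real.log_le_log two_pos hk2')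
        calc (1 : ℝ) = 1 / pugMean t p ^ 2 * pugMean t p ^ 2 := by field_simp
          _ ≤ pugLoss d t p * (1024 * (ε + Real.log k)) :=
            mul_le_mul h3 (hM2.trans (by linarith)) hM0.le hL0
      have h5 : 2 / (k : ℝ) ≤ pugLoss d t p * (2048 * ((ε + Real.log k) / k)) := by
        calc 2 / (k : ℝ) = 2 / k * 1 := (mul_one _).symm
          _ ≤ 2 / k * (pugLoss d t p * (1024 * (ε + Real.log k))) := by gcongr
          _ = _ := by ring
      have : 0 ≤ 1 / (k : ℝ) ^ 2 := by positivity
      linarith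
  have hmono : pugLoss d t p * (72 * (ε / k)) ≤
      pugLoss d t p * (72 * ((ε + Real.log k) / k)) := by
    gcongr; linarith
  rw [hdecomp]
  nlinarith

/-! ### Existence of optimized parameters -/

lemma add_mul_pugMean_pos {d : ℕ} (hd : 1 ≤ d) {p : ℝ} (hp : p ∈ Set.Icc (0 : ℝ) 1) (t : ℝ) :
    0 < d + t * pugMean t p := by
  have hd0 : (1 : ℝ) ≤ d := by exact_mod_cast hd
  by_cases hM : pugMean t p = 0
  · rw [hM]; linarith
  · have := pugMean_sq_le hp t
    have : 0 < pugMean t p ^ 2 := by positivity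
    linarith

lemma continuous_uncurry_pugMean : Continuous fun x : ℝ × ℝ => pugMean x.1 x.2 := by
  unfold pugMean
  have h1 := continuous_cdf_gaussianReal
  have h2 := continuous_gaussianPDFReal_zero_one
  refine (h2.comp continuous_fst).mul
    ((continuous_snd.div ?_ ?_).sub ((?_ : Continuous _).div ?_ ?_))
  · exact continuous_const.sub (h1.comp continuous_fst)
  · exact fun x => (sub_pos.2 (cdf_gaussianReal_lt_one x.1)).ne'
  · exact continuous_const.sub continuous_snd
  · exact h1.comp continuous_fst
  · exact fun x => (cdf_gaussianReal_pos x.1).ne'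

lemma isClosed_setOf_pugRatio (ε : ℝ) : IsClosed {x : ℝ × ℝ | PugRatio ε x.1 x.2} := by
  have h1 : Continuous fun x : ℝ × ℝ => cdf (gaussianReal 0 1) x.1 :=
    continuous_cdf_gaussianReal.comp continuous_fst
  have hA : Continuous fun x : ℝ × ℝ => x.2 / (1 - cdf (gaussianReal 0 1) x.1) :=
    continuous_snd.div (continuous_const.sub h1)
      fun x => (sub_pos.2 (cdf_gaussianReal_lt_one x.1)).ne'
  have hB : Continuous fun x : ℝ × ℝ => (1 - x.2) / cdf (gaussianReal 0 1) x.1 :=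
    (continuous_const.sub continuous_snd).div h1 fun x => (cdf_gaussianReal_pos x.1).ne'
  exact (isClosed_le hA (continuous_const.mul hB)).inter
    (isClosed_le hB (continuous_const.mul hA))

/-- The parameters `q = 1 / 2` and `p = e ^ ε / (1 + e ^ ε)` are private. -/
lemma exists_pugRatio {ε : ℝ} (hε : 0 < ε) :
    ∃ p ∈ Set.Icc (0 : ℝ) 1, PugRatio ε 0 p ∧ pugMean 0 p ≠ 0 := by
  have he := Real.exp_pos ε
  have he1 : 1 < Real.exp ε := Real.one_lt_exp_iff.2 hε
  have h1 : 1 - Real.exp ε / (1 + Real.exp ε) = 1 / (1 + Real.exp ε) := by field_simp; ring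
  refine ⟨Real.exp ε / (1 + Real.exp ε), ⟨by positivity, ?_⟩, ⟨?_, ?_⟩, ?_⟩
  · rw [div_le_one (by positivity)]; linarith
  · rw [h1, cdf_gaussianReal_zero]
    apply le_of_eq
    field_simp
    norm_num
  · rw [h1, cdf_gaussianReal_zero]
    have : 1 / (1 + Real.exp ε) ≤ Real.exp ε / (1 + Real.exp ε) * Real.exp ε := by
      rw [div_mul_eq_mul_div]
      gcongr
      nlinarith
    norm_num at this ⊢
    linarith
  · unfold pugMean
    rw [h1, cdf_gaussianReal_zero]
    refine mul_ne_zero (gaussianPDFReal_pos 0 1 0 one_ne_zero).ne' (ne_of_gt ?_)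
    have : 1 / (1 + Real.exp ε) < Real.exp ε / (1 + Real.exp ε) := by gcongr
    norm_num at this ⊢
    linarith

/-- Far from the origin the privacy constraint makes the mean small, both by itself and after
multiplication by the threshold. -/
lemma abs_pugMean_le_div {ε t p : ℝ} (h : PugRatio ε t p) (hp : p ∈ Set.Icc (0 : ℝ) 1)
    (ht : 1 ≤ |t|) :
    |pugMean t p| ≤ Real.exp ε / |t| ∧ |t * pugMean t p| ≤ Real.exp ε / |t| := by
  have h0 : 0 < |t| := by linarith
  have h1 : gaussianPDFReal 0 1 t ≤ 1 / |t| ^ 2 := by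
    have h2 := exp_neg_le_one_div (x := |t| ^ 2 / 2) (by positivity)
    rw [← neg_div, sq_abs] at h2
    refine (gaussianPDFReal_zero_one_le t).trans ?_
    have h3 : 1 / (1 + t ^ 2 / 2) ≤ 2 / |t| ^ 2 := by
      rw [← sq_abs t, div_le_div_iff₀ (by positivity) (by positivity)]
      nlinarith
    have h4 : 2 / |t| ^ 2 = 2 * (1 / |t| ^ 2) := by ring
    linarith
  have h2 : |pugMean t p| ≤ Real.exp ε / |t| ^ 2 := by
    refine (abs_pugMean_le h hp).trans ?_
    rw [div_eq_mul_one_div, mul_comm]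
    gcongr
  refine ⟨h2.trans ?_, ?_⟩
  · gcongr
    nlinarith
  · rw [abs_mul]
    refine (mul_le_mul_of_nonneg_left h2 h0.le).trans (le_of_eq ?_)
    field_simp

/-- The quotient `m² / (σ² 𝔼 ‖α v + V^⊥‖²)` attains a positive maximum on the private parameters:
it is continuous, and tends to zero as the threshold tends to infinity. -/
lemma exists_max_pugQuotient {ε : ℝ} (hε : 0 < ε) {d : ℕ} (hd : 1 ≤ d) :
    ∃ t p : ℝ, p ∈ Set.Icc (0 : ℝ) 1 ∧ PugRatio ε t p ∧ pugMean t p ≠ 0 ∧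
      ∀ t' p' : ℝ, p' ∈ Set.Icc (0 : ℝ) 1 → PugRatio ε t' p' →
        pugMean t' p' ^ 2 / (d + t' * pugMean t' p') ≤
          pugMean t p ^ 2 / (d + t * pugMean t p) := by
  obtain ⟨p₀, hp₀, hr₀, hM₀⟩ := exists_pugRatio hε
  have hd0 : (1 : ℝ) ≤ d := by exact_mod_cast hd
  set G : ℝ × ℝ → ℝ := fun x => pugMean x.1 x.2 ^ 2 / (d + x.1 * pugMean x.1 x.2) with hG
  have hG₀ : 0 < G (0, p₀) := div_pos (by positivity) (add_mul_pugMean_pos hd hp₀ 0)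
  set δ : ℝ := min (1 / 2) (G (0, p₀)) with hδ
  have hδ0 : 0 < δ := lt_min (by norm_num) hG₀
  set T : ℝ := Real.exp ε / δ with hT
  have hT1 : 1 ≤ T := by
    rw [hT, le_div_iff₀ hδ0, one_mul]
    exact (min_le_left _ _).trans (by linarith [Real.one_le_exp hε.le])
  have hK : IsCompact ((Set.Icc (-T) T ×ˢ Set.Icc (0 : ℝ) 1) ∩ {x | PugRatio ε x.1 x.2}) :=
    (isCompact_Icc.prod isCompact_Icc).inter_right (isClosed_setOf_pugRatio ε)
  have hcont : ContinuousOn G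
      ((Set.Icc (-T) T ×ˢ Set.Icc (0 : ℝ) 1) ∩ {x | PugRatio ε x.1 x.2}) := by
    refine ContinuousOn.div (continuous_uncurry_pugMean.pow 2).continuousOn
      (continuous_const.add (continuous_fst.mul continuous_uncurry_pugMean)).continuousOn ?_
    exact fun x hx => (add_mul_pugMean_pos hd hx.1.2 x.1).ne'
  have hmem : ((0 : ℝ), p₀) ∈
      (Set.Icc (-T) T ×ˢ Set.Icc (0 : ℝ) 1) ∩ {x : ℝ × ℝ | PugRatio ε x.1 x.2} :=
    ⟨⟨⟨by linarith, by linarith⟩, hp₀⟩, hr₀⟩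
  obtain ⟨⟨t, p⟩, ⟨⟨-, hp⟩, hr⟩, hmax⟩ := hK.exists_isMaxOn ⟨_, hmem⟩ hcont
  have hmax0 : G (0, p₀) ≤ G (t, p) := hmax hmem
  refine ⟨t, p, hp, hr, ?_, fun t' p' hp' hr' => ?_⟩
  · intro h0
    have : G (t, p) = 0 := by simp [hG, h0]
    linarith
  · by_cases ht' : |t'| ≤ T
    · exact hmax (a := (t', p')) ⟨⟨abs_le.1 ht', hp'⟩, hr'⟩
    · refine le_trans ?_ hmax0
      push Not at ht'
      have ht0 : 0 < |t'| := by linarith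
      obtain ⟨h1, h2⟩ := abs_pugMean_le_div hr' hp' (hT1.trans ht'.le)
      have h3 : Real.exp ε / |t'| ≤ δ := by
        rw [div_le_iff₀ ht0, mul_comm, ← div_le_iff₀ hδ0]
        exact ht'.le
      have hδ1 : δ ≤ 1 / 2 := min_le_left _ _
      have hδ2 : δ ≤ G (0, p₀) := min_le_right _ _
      have h4 : -(1 / 2) ≤ t' * pugMean t' p' := by
        have := neg_abs_le (t' * pugMean t' p'); linarith
      have h5 : pugMean t' p' ^ 2 ≤ δ ^ 2 := by
        rw [← sq_abs]; exact pow_le_pow_left₀ (abs_nonneg _) (h1.trans h3) 2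
      rw [div_le_iff₀ (by linarith)]
      have h7 : δ ^ 2 ≤ δ * (1 / 2) := by rw [sq]; gcongr
      have h8 : (1 / 2 : ℝ) ≤ d + t' * pugMean t' p' := by linarith
      calc pugMean t' p' ^ 2 ≤ δ * (1 / 2) := h5.trans h7
        _ ≤ G (0, p₀) * (d + t' * pugMean t' p') := by gcongr

lemma pugLoss_eq_inv {d : ℕ} (t p : ℝ) :
    pugLoss d t p = (pugMean t p ^ 2 / (d + t * pugMean t p))⁻¹ - 1 := by
  rw [inv_div, pugLoss]

theorem exists_pugOptimal {ε : ℝ} (hε : 0 < ε) {d : ℕ} (hd : 1 ≤ d) :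
    ∃ p q : ℝ, PugOptimal ε d p q ∧ ∀ n : ℕ, 1 ≤ n → pugError n d p q < ⊤ := by
  obtain ⟨t, p, hp, hr, hM, hmax⟩ := exists_max_pugQuotient hε hd
  refine ⟨p, cdf (gaussianReal 0 1) t,
    ⟨(pugAdmissible_cdf_iff hε.le hd).2 ⟨hp, hM, hr⟩, fun p' q' h' => ?_⟩, fun n hn => ?_⟩
  · obtain ⟨t', rfl⟩ := h'.exists_cdf
    obtain ⟨hp', hM', hr'⟩ := (pugAdmissible_cdf_iff hε.le hd).1 h'
    rw [pugError_eq le_rfl hd hp hM, pugError_eq le_rfl hd hp' hM', pugLoss_eq_inv,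
      pugLoss_eq_inv]
    have h1 := hmax t' p' hp' hr'
    have h2 : 0 < pugMean t' p' ^ 2 / (d + t' * pugMean t' p') :=
      div_pos (by positivity) (add_mul_pugMean_pos hd hp' t')
    gcongr
  · rw [pugError_eq hn hd hp hM]
    exact ENNReal.ofReal_lt_top

/-- The loss of parameters that are optimized in dimension `d` is at most that of any private
parameters. -/
lemma PugOptimal.pugLoss_le {ε : ℝ} (hε : 0 < ε) {d : ℕ} (hd : 1 ≤ d) {p t : ℝ}
    (h : PugOptimal ε d p (cdf (gaussianReal 0 1) t)) {p' t' : ℝ} (hp' : p' ∈ Set.Icc (0 : ℝ) 1)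
    (hM' : pugMean t' p' ≠ 0) (hr' : PugRatio ε t' p') : pugLoss d t p ≤ pugLoss d t' p' := by
  obtain ⟨hp, hM, -⟩ := (pugAdmissible_cdf_iff hε.le hd).1 h.1
  have := h.2 p' (cdf (gaussianReal 0 1) t') ((pugAdmissible_cdf_iff hε.le hd).2 ⟨hp', hM', hr'⟩)
  rw [pugError_eq le_rfl hd hp hM, pugError_eq le_rfl hd hp' hM', Nat.cast_one, div_one, div_one,
    ENNReal.ofReal_le_ofReal_iff (pugLoss_nonneg hd hp' hM')] at this
  exact this

/-! ### Matrices acting on Euclidean space -/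

section MatrixAction

variable {k l d : ℕ}

instance secondCountableTopology_matrix : SecondCountableTopology (Matrix (Fin k) (Fin d) ℝ) :=
  inferInstanceAs (SecondCountableTopology (Fin k → Fin d → ℝ))

instance secondCountableTopology_orthogonalGroup :
    SecondCountableTopology (Matrix.orthogonalGroup (Fin d) ℝ) :=
  TopologicalSpace.Subtype.secondCountableTopology _

lemma toEuclideanLin_coord (A : Matrix (Fin k) (Fin d) ℝ) (x : EuclideanSpace ℝ (Fin d))
    (i : Fin k) : Matrix.toEuclideanLin A x i = ∑ j, A i j * x j := rfl

lemma toEuclideanLin_mul (A : Matrix (Fin k) (Fin l) ℝ) (B : Matrix (Fin l) (Fin d) ℝ)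
    (x : EuclideanSpace ℝ (Fin d)) :
    Matrix.toEuclideanLin (A * B) x = Matrix.toEuclideanLin A (Matrix.toEuclideanLin B x) := by
  ext i
  exact congrFun (Matrix.mulVec_mulVec x.ofLp A B).symm i

lemma toEuclideanLin_one (x : EuclideanSpace ℝ (Fin d)) :
    Matrix.toEuclideanLin (1 : Matrix (Fin d) (Fin d) ℝ) x = x := by
  ext i
  exact congrFun (Matrix.one_mulVec x.ofLp) i

lemma inner_toEuclideanLin (A : Matrix (Fin k) (Fin d) ℝ) (x : EuclideanSpace ℝ (Fin d))
    (y : EuclideanSpace ℝ (Fin k)) :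
    ⟪y, Matrix.toEuclideanLin A x⟫_ℝ = ⟪Matrix.toEuclideanLin Aᵀ y, x⟫_ℝ := by
  simp only [PiLp.inner_apply, toEuclideanLin_coord, RCLike.inner_apply, conj_trivial,
    Matrix.transpose_apply, Finset.sum_mul, Finset.mul_sum]
  rw [Finset.sum_comm]
  exact Finset.sum_congr rfl fun _ _ => Finset.sum_congr rfl fun _ _ => by ring

lemma continuous_uncurry_toEuclideanLin :
    Continuous fun x : Matrix (Fin k) (Fin d) ℝ × EuclideanSpace ℝ (Fin d) =>
      Matrix.toEuclideanLin x.1 x.2 := by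
  rw [← (PiLp.homeomorph 2 (fun _ : Fin k => ℝ)).comp_continuous_iff]
  refine continuous_pi fun i => ?_
  change Continuous fun x : Matrix (Fin k) (Fin d) ℝ × EuclideanSpace ℝ (Fin d) =>
    ∑ j, x.1 i j * x.2 j
  refine continuous_finsetSum _ fun j _ => Continuous.mul ?_ (by fun_prop)
  exact (continuous_apply j).comp ((continuous_apply i).comp continuous_fst)

lemma continuous_toEuclideanLin (v : EuclideanSpace ℝ (Fin d)) :
    Continuous fun A : Matrix (Fin k) (Fin d) ℝ => Matrix.toEuclideanLin A v :=
  continuous_uncurry_toEuclideanLin.comp (by fun_prop : Continuous fun A => (A, v))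

lemma transpose_mul_self_orthogonal (U : Matrix.orthogonalGroup (Fin d) ℝ) :
    (U : Matrix (Fin d) (Fin d) ℝ)ᵀ * U = 1 :=
  (Matrix.mem_orthogonalGroup_iff' (Fin d) ℝ).1 U.2

lemma mul_transpose_self_orthogonal (U : Matrix.orthogonalGroup (Fin d) ℝ) :
    (U : Matrix (Fin d) (Fin d) ℝ) * (U : Matrix (Fin d) (Fin d) ℝ)ᵀ = 1 :=
  (Matrix.mem_orthogonalGroup_iff (Fin d) ℝ).1 U.2

lemma norm_toEuclideanLin_orthogonal (U : Matrix.orthogonalGroup (Fin d) ℝ)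
    (x : EuclideanSpace ℝ (Fin d)) :
    ‖Matrix.toEuclideanLin (U : Matrix (Fin d) (Fin d) ℝ) x‖ = ‖x‖ := by
  rw [← sq_eq_sq₀ (norm_nonneg _) (norm_nonneg _), ← real_inner_self_eq_norm_sq,
    inner_toEuclideanLin, ← toEuclideanLin_mul, transpose_mul_self_orthogonal, toEuclideanLin_one,
    real_inner_self_eq_norm_sq]

lemma exists_orthogonal_of_linearIsometryEquiv
    (L : EuclideanSpace ℝ (Fin d) ≃ₗᵢ[ℝ] EuclideanSpace ℝ (Fin d)) :
    ∃ Q : Matrix.orthogonalGroup (Fin d) ℝ,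
      ∀ x, Matrix.toEuclideanLin (Q : Matrix (Fin d) (Fin d) ℝ) x = L x := by
  set A := Matrix.toEuclideanLin.symm (L.toLinearEquiv : EuclideanSpace ℝ (Fin d) →ₗ[ℝ]
    EuclideanSpace ℝ (Fin d)) with hA
  have hAL : ∀ x, Matrix.toEuclideanLin A x = L x := fun x => by
    rw [hA, LinearEquiv.apply_symm_apply]; rfl
  refine ⟨⟨A, (Matrix.mem_orthogonalGroup_iff' (Fin d) ℝ).2 ?_⟩, hAL⟩
  apply Matrix.toEuclideanLin.injective
  refine LinearMap.ext fun x => ext_inner_left ℝ fun y => ?_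
  have h := inner_toEuclideanLin Aᵀ (Matrix.toEuclideanLin A x) y
  rw [Matrix.transpose_transpose, hAL, hAL, L.inner_map_map] at h
  refine Eq.trans ?_ (h.trans ?_)
  · rw [← hAL, ← toEuclideanLin_mul]
  · rw [toEuclideanLin_one]

/-- The orthogonal group acts transitively on the unit sphere. -/
lemma exists_orthogonal_map_eq {e e' : EuclideanSpace ℝ (Fin d)} (h : ‖e‖ = ‖e'‖) :
    ∃ Q : Matrix.orthogonalGroup (Fin d) ℝ,
      Matrix.toEuclideanLin (Q : Matrix (Fin d) (Fin d) ℝ) e = e' := by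
  obtain ⟨Q, hQ⟩ := exists_orthogonal_of_linearIsometryEquiv (ℝ ∙ (e - e'))ᗮ.reflection
  exact ⟨Q, (hQ e).trans (Submodule.reflection_sub h)⟩

end MatrixAction

/-! ### Uniformly random rotations -/

section Rotation

variable {d : ℕ}

instance isHaarMeasure_uniformRotation : (uniformRotation d).IsHaarMeasure := by
  unfold uniformRotation; infer_instance

instance isMulRightInvariant_uniformRotation : (uniformRotation d).IsMulRightInvariant := by
  constructor
  intro g
  have hm : AEMeasurable (· * g) (uniformRotation d) := (measurable_mul_const g).aemeasurable
  have h1 : IsProbabilityMeasure ((uniformRotation d).map (· * g)) :=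
    Measure.isProbabilityMeasure_map hm
  have h2 : ((uniformRotation d).map (· * g)).IsHaarMeasure :=
    Measure.isHaarMeasure_of_isCompact_nonempty_interior _ Set.univ isCompact_univ (by simp)
      (by simp) (by simp)
  exact Measure.isHaarMeasure_eq_of_isProbabilityMeasure _ _

lemma integrable_uniformRotation {F : Type*} [NormedAddCommGroup F]
    {g : Matrix.orthogonalGroup (Fin d) ℝ → F} (hg : Continuous g) :
    Integrable g (uniformRotation d) :=
  hg.integrable_of_hasCompactSupport (HasCompactSupport.of_compactSpace g)

/-- The entry of `U v` in the direction of a unit vector `e` has a law that does not depend on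
`e`. -/
lemma integral_inner_pow_eq (v : EuclideanSpace ℝ (Fin d)) {e e' : EuclideanSpace ℝ (Fin d)}
    (h : ‖e‖ = ‖e'‖) (r : ℕ) :
    ∫ U, ⟪e, Matrix.toEuclideanLin (U : Matrix (Fin d) (Fin d) ℝ) v⟫_ℝ ^ r ∂(uniformRotation d) =
      ∫ U, ⟪e', Matrix.toEuclideanLin (U : Matrix (Fin d) (Fin d) ℝ) v⟫_ℝ ^ r
        ∂(uniformRotation d) := by
  obtain ⟨Q, hQ⟩ := exists_orthogonal_map_eq h
  rw [← integral_mul_left_eq_self (μ := uniformRotation d) (fun U =>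
    ⟪e', Matrix.toEuclideanLin (U : Matrix (Fin d) (Fin d) ℝ) v⟫_ℝ ^ r) Q]
  refine integral_congr_ae (ae_of_all _ fun U => ?_)
  dsimp only
  congr 1
  rw [Submonoid.coe_mul, toEuclideanLin_mul, ← hQ,
    inner_toEuclideanLin (Q : Matrix (Fin d) (Fin d) ℝ),
    ← toEuclideanLin_mul, transpose_mul_self_orthogonal, toEuclideanLin_one]

lemma integral_inner_pow_eq_norm_pow (v e e' : EuclideanSpace ℝ (Fin d)) (he' : ‖e'‖ = 1)
    (r : ℕ) :
    ∫ U, ⟪e, Matrix.toEuclideanLin (U : Matrix (Fin d) (Fin d) ℝ) v⟫_ℝ ^ r ∂(uniformRotation d) =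
      ‖e‖ ^ r * ∫ U, ⟪e', Matrix.toEuclideanLin (U : Matrix (Fin d) (Fin d) ℝ) v⟫_ℝ ^ r
        ∂(uniformRotation d) := by
  rw [integral_inner_pow_eq v (e' := ‖e‖ • e') (by rw [norm_smul, he', mul_one, norm_norm]) r,
    ← integral_const_mul]
  simp_rw [inner_smul_left, mul_pow]
  rfl

lemma continuous_rotation_apply (v : EuclideanSpace ℝ (Fin d)) :
    Continuous fun U : Matrix.orthogonalGroup (Fin d) ℝ =>
      Matrix.toEuclideanLin (U : Matrix (Fin d) (Fin d) ℝ) v :=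
  (continuous_toEuclideanLin v).comp continuous_subtype_val

/-- The `i`-th coordinate of `U v`. -/
noncomputable def rotationCoord (v : EuclideanSpace ℝ (Fin d)) (i : Fin d)
    (U : Matrix.orthogonalGroup (Fin d) ℝ) : ℝ :=
  Matrix.toEuclideanLin (U : Matrix (Fin d) (Fin d) ℝ) v i

lemma inner_single_rotation (v : EuclideanSpace ℝ (Fin d)) (i : Fin d)
    (U : Matrix.orthogonalGroup (Fin d) ℝ) :
    ⟪EuclideanSpace.single i (1 : ℝ), Matrix.toEuclideanLin (U : Matrix (Fin d) (Fin d) ℝ) v⟫_ℝ =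
      rotationCoord v i U := by
  rw [EuclideanSpace.inner_single_left, map_one, one_mul]
  rfl

@[fun_prop]
lemma continuous_rotationCoord (v : EuclideanSpace ℝ (Fin d)) (i : Fin d) :
    Continuous (rotationCoord v i) :=
  (EuclideanSpace.proj (𝕜 := ℝ) i).continuous.comp (continuous_rotation_apply v)

lemma sum_rotationCoord_sq {v : EuclideanSpace ℝ (Fin d)} (hv : ‖v‖ = 1)
    (U : Matrix.orthogonalGroup (Fin d) ℝ) : ∑ i, rotationCoord v i U ^ 2 = 1 := by
  unfold rotationCoord
  rw [← EuclideanSpace.real_norm_sq_eq, norm_toEuclideanLin_orthogonal, hv, one_pow]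

lemma integral_rotationCoord_pow_eq (v : EuclideanSpace ℝ (Fin d)) (i j : Fin d) (r : ℕ) :
    ∫ U, rotationCoord v i U ^ r ∂(uniformRotation d) =
      ∫ U, rotationCoord v j U ^ r ∂(uniformRotation d) := by
  have h := integral_inner_pow_eq v (e := EuclideanSpace.single i (1 : ℝ))
    (e' := EuclideanSpace.single j (1 : ℝ)) (by simp) r
  simpa only [inner_single_rotation] using h

lemma integral_rotationCoord_sq {v : EuclideanSpace ℝ (Fin d)} (hv : ‖v‖ = 1) (i : Fin d) :
    ∫ U, rotationCoord v i U ^ 2 ∂(uniformRotation d) = (d : ℝ)⁻¹ := by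
  have hI : ∀ j, Integrable (fun U => rotationCoord v j U ^ 2) (uniformRotation d) := fun j =>
    integrable_uniformRotation (by fun_prop)
  have h : ∫ U, ∑ j, rotationCoord v j U ^ 2 ∂(uniformRotation d) = 1 := by
    simp_rw [sum_rotationCoord_sq hv]
    simp
  rw [integral_finsetSum _ fun j _ => hI j] at h
  simp_rw [fun j => integral_rotationCoord_pow_eq v j i 2] at h
  rw [Finset.sum_const, Finset.card_univ, Fintype.card_fin, nsmul_eq_mul] at h
  exact eq_inv_of_mul_eq_one_right h

/-- The mixed fourth moments of `U v` are one third of the pure ones: the fourth moments in the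
directions `e_i + e_j` and `e_i - e_j` are both equal to four times the one in the direction
`e_i`. -/
lemma integral_rotationCoord_sq_mul_sq (v : EuclideanSpace ℝ (Fin d)) {i j : Fin d}
    (hij : i ≠ j) :
    ∫ U, rotationCoord v i U ^ 2 * rotationCoord v j U ^ 2 ∂(uniformRotation d) =
      (∫ U, rotationCoord v i U ^ 4 ∂(uniformRotation d)) / 3 := by
  set ei : EuclideanSpace ℝ (Fin d) := EuclideanSpace.single i (1 : ℝ) with hei
  set ej : EuclideanSpace ℝ (Fin d) := EuclideanSpace.single j (1 : ℝ) with hej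
  have hei1 : ‖ei‖ = 1 := by simp [hei]
  have hej1 : ‖ej‖ = 1 := by simp [hej]
  have horth : ⟪ei, ej⟫_ℝ = 0 := by
    simp [hei, hej, EuclideanSpace.inner_single_left, hij]
  have hplus : ‖ei + ej‖ ^ 4 = 4 := by
    rw [show (4 : ℕ) = 2 * 2 from rfl, pow_mul, norm_add_sq_real, horth, hei1, hej1]; norm_num
  have hminus : ‖ei - ej‖ ^ 4 = 4 := by
    rw [show (4 : ℕ) = 2 * 2 from rfl, pow_mul, norm_sub_sq_real, horth, hei1, hej1]; norm_num
  have h1 := integral_inner_pow_eq_norm_pow v (ei + ej) ei hei1 4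
  have h2 := integral_inner_pow_eq_norm_pow v (ei - ej) ei hei1 4
  simp only [inner_add_left, inner_sub_left, hei, hej, inner_single_rotation] at h1 h2
  rw [← hei, ← hej, hplus] at h1
  rw [← hei, ← hej, hminus] at h2
  have hI : ∀ r s : ℕ, Integrable (fun U => rotationCoord v i U ^ r * rotationCoord v j U ^ s)
      (uniformRotation d) := fun r s => integrable_uniformRotation (by fun_prop)
  have hexp : ∫ U, (rotationCoord v i U + rotationCoord v j U) ^ 4 ∂(uniformRotation d) +
      ∫ U, (rotationCoord v i U - rotationCoord v j U) ^ 4 ∂(uniformRotation d) =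
      2 * ∫ U, rotationCoord v i U ^ 4 ∂(uniformRotation d) +
      12 * ∫ U, rotationCoord v i U ^ 2 * rotationCoord v j U ^ 2 ∂(uniformRotation d) +
      2 * ∫ U, rotationCoord v j U ^ 4 ∂(uniformRotation d) := by
    have hi4 : Integrable (fun U => rotationCoord v i U ^ 4) (uniformRotation d) := by
      simpa using hI 4 0
    have hj4 : Integrable (fun U => rotationCoord v j U ^ 4) (uniformRotation d) := by
      simpa using hI 0 4
    have h5 : Integrable (fun U => 2 * rotationCoord v i U ^ 4 +
        12 * (rotationCoord v i U ^ 2 * rotationCoord v j U ^ 2)) (uniformRotation d) :=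
      (hi4.const_mul 2).add ((hI 2 2).const_mul 12)
    rw [← integral_add (integrable_uniformRotation (by fun_prop))
      (integrable_uniformRotation (by fun_prop)), ← integral_const_mul, ← integral_const_mul,
      ← integral_const_mul, ← integral_add (hi4.const_mul 2) ((hI 2 2).const_mul 12),
      ← integral_add h5 (hj4.const_mul 2)]
    congr 1
    ext U
    ring
  rw [h1, h2, integral_rotationCoord_pow_eq v j i 4] at hexp
  linarith

lemma sum_ite_eq_add_third (k : ℕ) (a : ℝ) :
    ∑ i : Fin k, ∑ j : Fin k, (if i = j then a else a / 3) = k * (k + 2) * (a / 3) := by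
  have : ∀ i j : Fin k,
      (if i = j then a else a / 3) = a / 3 + if i = j then 2 * (a / 3) else 0 := by
    intro i j; split_ifs <;> ring
  simp_rw [this, Finset.sum_add_distrib]
  simp
  ring

/-- Sampling `k` coordinates of `U v`: the second moment of the squared norm. -/
lemma integral_sum_rotationCoord_sq_sq {k : ℕ} (f : Fin k ↪ Fin d) {v : EuclideanSpace ℝ (Fin d)}
    {a : ℝ} (ha : ∀ i, ∫ U, rotationCoord v i U ^ 4 ∂(uniformRotation d) = a) :
    ∫ U, (∑ i, rotationCoord v (f i) U ^ 2) ^ 2 ∂(uniformRotation d) = k * (k + 2) * (a / 3) := by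
  have hI : ∀ i j, Integrable (fun U => rotationCoord v i U ^ 2 * rotationCoord v j U ^ 2)
      (uniformRotation d) := fun i j => integrable_uniformRotation (by fun_prop)
  simp_rw [sq (∑ i, _ ^ 2), Finset.sum_mul_sum]
  rw [integral_finsetSum _ fun i _ => integrable_finsetSum _ fun j _ => hI (f i) (f j),
    ← sum_ite_eq_add_third]
  refine Finset.sum_congr rfl fun i _ => ?_
  rw [integral_finsetSum _ fun j _ => hI (f i) (f j)]
  refine Finset.sum_congr rfl fun j _ => ?_
  split_ifs with hij
  · subst hij
    rw [← ha (f i)]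
    congr 1; ext U; ring
  · rw [integral_rotationCoord_sq_mul_sq v fun h => hij (f.injective h), ha]

lemma integral_sampled_sq_sq {k : ℕ} (hk : 1 ≤ k) (hkd : k ≤ d) (f : Fin k ↪ Fin d)
    {v : EuclideanSpace ℝ (Fin d)} (hv : ‖v‖ = 1) :
    ∫ U, (∑ i, rotationCoord v (f i) U ^ 2) ^ 2 ∂(uniformRotation d) =
      (k * (k + 2)) / (d * (d + 2)) := by
  have hd : 0 < d := by omega
  have ha := fun i => integral_rotationCoord_pow_eq v i (⟨0, hd⟩ : Fin d) 4
  have h1 := integral_sum_rotationCoord_sq_sq (Function.Embedding.refl (Fin d)) ha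
  simp only [Function.Embedding.refl_apply, sum_rotationCoord_sq hv] at h1
  rw [integral_sum_rotationCoord_sq_sq f ha, eq_div_iff (by positivity)]
  simp only [one_pow, integral_const, probReal_univ, smul_eq_mul, mul_one] at h1
  linear_combination (-(k : ℝ) * (k + 2)) * h1

lemma continuous_uncurry_rotationCoord (i : Fin d) :
    Continuous fun x : Matrix.orthogonalGroup (Fin d) ℝ × EuclideanSpace ℝ (Fin d) =>
      rotationCoord x.2 i x.1 :=
  (EuclideanSpace.proj (𝕜 := ℝ) i).continuous.comp (continuous_uncurry_toEuclideanLin.comp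
    ((continuous_subtype_val.comp continuous_fst).prodMk continuous_snd))

lemma ae_volume_rotationCoord_ne_zero (U : Matrix.orthogonalGroup (Fin d) ℝ) (i : Fin d) :
    ∀ᵐ z ∂(volume : Measure (EuclideanSpace ℝ (Fin d))), rotationCoord z i U ≠ 0 := by
  set K : Submodule ℝ (EuclideanSpace ℝ (Fin d)) := LinearMap.ker
    ((EuclideanSpace.proj (𝕜 := ℝ) i).toLinearMap ∘ₗ
      Matrix.toEuclideanLin (U : Matrix (Fin d) (Fin d) ℝ)) with hK
  have hmem : ∀ z, z ∈ K ↔ rotationCoord z i U = 0 := fun z => LinearMap.mem_ker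
  have hne : K ≠ ⊤ := by
    intro h
    have h0 := (hmem (Matrix.toEuclideanLin (U : Matrix (Fin d) (Fin d) ℝ)ᵀ
      (EuclideanSpace.single i 1))).1 (h ▸ Submodule.mem_top)
    rw [rotationCoord, ← toEuclideanLin_mul, mul_transpose_self_orthogonal,
      toEuclideanLin_one] at h0
    simp at h0
  rw [ae_iff]
  simp only [ne_eq, not_not, ← hmem]
  exact Measure.addHaar_submodule volume K hne

/-- A coordinate of `U v` is almost surely nonzero. For each `U`, the vectors `z` for which the
coordinate of `U z` vanishes form a null set, so that by Fubini's theorem the claim holds for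
almost every `z`, and by invariance for every nonzero one. -/
lemma ae_rotationCoord_ne_zero {v : EuclideanSpace ℝ (Fin d)} (hv : ‖v‖ = 1) (i : Fin d) :
    ∀ᵐ U ∂(uniformRotation d), rotationCoord v i U ≠ 0 := by
  have hS : MeasurableSet {x : Matrix.orthogonalGroup (Fin d) ℝ × EuclideanSpace ℝ (Fin d) |
      rotationCoord x.2 i x.1 ≠ 0} :=
    (isOpen_ne_fun (continuous_uncurry_rotationCoord i) continuous_const).measurableSet
  have h2 := (Measure.ae_ae_comm (μ := uniformRotation d) hS).1
    (ae_of_all _ fun U => ae_volume_rotationCoord_ne_zero U i)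
  have h3 : ∀ᵐ z ∂(volume : Measure (EuclideanSpace ℝ (Fin d))), z ≠ 0 := by
    have : Nontrivial (EuclideanSpace ℝ (Fin d)) :=
      ⟨v, 0, fun h => by simp [h] at hv⟩
    exact Measure.ae_ne volume 0
  obtain ⟨z, hz, hz0⟩ := (h2.and h3).exists
  obtain ⟨Q, hQ⟩ := exists_orthogonal_map_eq (e := z) (e' := ‖z‖ • v)
    (by rw [norm_smul, hv, mul_one, norm_norm])
  -- `U Q z = ‖z‖ U v`, and `U Q` has the law of `U`.
  have hUQ : ∀ U, rotationCoord z i (U * Q) = ‖z‖ * rotationCoord v i U := fun U => by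
    rw [rotationCoord, Submonoid.coe_mul, toEuclideanLin_mul, hQ, map_smul]
    rfl
  have h4 : ∀ᵐ U ∂(uniformRotation d), rotationCoord z i (U * Q) ≠ 0 :=
    (measurePreserving_mul_right (uniformRotation d) Q).quasiMeasurePreserving.ae
      (p := fun U => rotationCoord z i U ≠ 0) hz
  exact h4.mono fun U hU h0 => hU (by rw [hUQ, h0, mul_zero])

end Rotation

/-! ### The random projection `W` -/

section Projection

variable {k d : ℕ}

/-- The matrix `W = √(d/k) S U` for the sampled columns `f` and the rotation `U`. -/
noncomputable def sampledRotation (f : Fin k ↪ Fin d) (U : Matrix.orthogonalGroup (Fin d) ℝ) :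
    Matrix (Fin k) (Fin d) ℝ :=
  Real.sqrt ((d : ℝ) / k) • (samplingMatrix f * (U : Matrix (Fin d) (Fin d) ℝ))

lemma randomRotationProjection_eq : randomRotationProjection k d =
    (Fintype.card (Fin k ↪ Fin d) : ℝ≥0∞)⁻¹ •
      ∑ f : Fin k ↪ Fin d, (uniformRotation d).map (sampledRotation f) := rfl

lemma continuous_sampledRotation (f : Fin k ↪ Fin d) : Continuous (sampledRotation f) :=
  (Continuous.matrix_mul (continuous_const (y := samplingMatrix f))
    continuous_subtype_val).const_smul (Real.sqrt ((d : ℝ) / k))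

lemma samplingMatrix_mul_transpose (f : Fin k ↪ Fin d) :
    samplingMatrix f * (samplingMatrix f)ᵀ = 1 := by
  ext i j
  simp [Matrix.mul_apply, samplingMatrix, Matrix.one_apply, f.injective.eq_iff, eq_comm]

lemma sampledRotation_mul_transpose (f : Fin k ↪ Fin d) (U : Matrix.orthogonalGroup (Fin d) ℝ) :
    sampledRotation f U * (sampledRotation f U)ᵀ = ((d : ℝ) / k) • 1 := by
  rw [sampledRotation, Matrix.transpose_smul, Matrix.smul_mul, Matrix.mul_smul, smul_smul,
    Real.mul_self_sqrt (by positivity), Matrix.transpose_mul, Matrix.mul_assoc,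
    ← Matrix.mul_assoc _ _ (samplingMatrix f)ᵀ, mul_transpose_self_orthogonal, Matrix.one_mul,
    samplingMatrix_mul_transpose]

lemma sampledRotation_mul (f : Fin k ↪ Fin d) (U Q : Matrix.orthogonalGroup (Fin d) ℝ) :
    sampledRotation f (U * Q) = sampledRotation f U * (Q : Matrix (Fin d) (Fin d) ℝ) := by
  rw [sampledRotation, sampledRotation, Submonoid.coe_mul, Matrix.smul_mul, Matrix.mul_assoc]

lemma sampledRotation_coord (f : Fin k ↪ Fin d) (U : Matrix.orthogonalGroup (Fin d) ℝ)
    (v : EuclideanSpace ℝ (Fin d)) (i : Fin k) :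
    Matrix.toEuclideanLin (sampledRotation f U) v i =
      Real.sqrt ((d : ℝ) / k) * rotationCoord v (f i) U := by
  rw [sampledRotation, map_smul, LinearMap.smul_apply, toEuclideanLin_mul, PiLp.smul_apply,
    toEuclideanLin_coord]
  simp [samplingMatrix, rotationCoord]

lemma norm_sampledRotation_sq (f : Fin k ↪ Fin d) (U : Matrix.orthogonalGroup (Fin d) ℝ)
    (v : EuclideanSpace ℝ (Fin d)) :
    ‖Matrix.toEuclideanLin (sampledRotation f U) v‖ ^ 2 =
      (d : ℝ) / k * ∑ i, rotationCoord v (f i) U ^ 2 := by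
  rw [EuclideanSpace.real_norm_sq_eq, Finset.mul_sum]
  refine Finset.sum_congr rfl fun i _ => ?_
  rw [sampledRotation_coord, mul_pow, Real.sq_sqrt (by positivity)]

lemma card_embedding_ne_zero (hkd : k ≤ d) : (Fintype.card (Fin k ↪ Fin d) : ℝ≥0∞) ≠ 0 := by
  have : Nonempty (Fin k ↪ Fin d) := ⟨Fin.castLEEmb hkd⟩
  exact_mod_cast Fintype.card_ne_zero

lemma isProbabilityMeasure_randomRotationProjection (hkd : k ≤ d) :
    IsProbabilityMeasure (randomRotationProjection k d) := by
  constructor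
  have h : ∀ f : Fin k ↪ Fin d, (uniformRotation d).map (sampledRotation f) Set.univ = 1 :=
    fun f => by
      rw [Measure.map_apply (continuous_sampledRotation f).measurable MeasurableSet.univ]
      simp
  rw [randomRotationProjection_eq, Measure.smul_apply, Measure.finsetSum_apply]
  simp only [h, Finset.sum_const, Finset.card_univ, nsmul_eq_mul, mul_one, smul_eq_mul]
  exact ENNReal.inv_mul_cancel (card_embedding_ne_zero hkd) (ENNReal.natCast_ne_top _)

lemma ae_randomRotationProjection {p : Matrix (Fin k) (Fin d) ℝ → Prop}
    (hp : MeasurableSet {W | p W})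
    (h : ∀ f : Fin k ↪ Fin d, ∀ᵐ U ∂(uniformRotation d), p (sampledRotation f U)) :
    ∀ᵐ W ∂(randomRotationProjection k d), p W := by
  rw [randomRotationProjection_eq]
  refine Measure.ae_smul_measure ?_ _
  rw [ae_iff, Measure.finsetSum_apply]
  refine Finset.sum_eq_zero fun f _ => ?_
  rw [← ae_iff]
  exact (ae_map_iff (continuous_sampledRotation f).aemeasurable hp).2 (h f)

lemma integrable_randomRotationProjection (hkd : k ≤ d) {g : Matrix (Fin k) (Fin d) ℝ → ℝ}
    (hg : Continuous g) : Integrable g (randomRotationProjection k d) := by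
  rw [randomRotationProjection_eq]
  refine Integrable.smul_measure ?_ (ENNReal.inv_ne_top.2 (card_embedding_ne_zero hkd))
  refine integrable_finsetSum_measure.2 fun f _ => ?_
  rw [integrable_map_measure hg.aestronglyMeasurable (continuous_sampledRotation f).aemeasurable]
  exact integrable_uniformRotation (hg.comp (continuous_sampledRotation f))

lemma integral_randomRotationProjection_of_forall (hkd : k ≤ d)
    {g : Matrix (Fin k) (Fin d) ℝ → ℝ} (hg : Continuous g) {a : ℝ}
    (h : ∀ f : Fin k ↪ Fin d, ∫ U, g (sampledRotation f U) ∂(uniformRotation d) = a) :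
    ∫ W, g W ∂(randomRotationProjection k d) = a := by
  have hi : ∀ f : Fin k ↪ Fin d, Integrable g ((uniformRotation d).map (sampledRotation f)) :=
    fun f => by
      rw [integrable_map_measure hg.aestronglyMeasurable
        (continuous_sampledRotation f).aemeasurable]
      exact integrable_uniformRotation (hg.comp (continuous_sampledRotation f))
  have he : ∀ f : Fin k ↪ Fin d, ∫ W, g W ∂((uniformRotation d).map (sampledRotation f)) = a :=
    fun f => by
      rw [integral_map (continuous_sampledRotation f).aemeasurable hg.aestronglyMeasurable, h]
  have hc : (Fintype.card (Fin k ↪ Fin d) : ℝ) ≠ 0 := by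
    have := card_embedding_ne_zero hkd
    exact_mod_cast this
  rw [randomRotationProjection_eq, integral_smul_measure,
    integral_finsetSum_measure fun f _ => hi f]
  simp only [he, Finset.sum_const, Finset.card_univ, nsmul_eq_mul, ENNReal.toReal_inv,
    ENNReal.toReal_natCast, smul_eq_mul]
  rw [← mul_assoc, inv_mul_cancel₀ hc, one_mul]

lemma continuous_mul_orthogonal (Q : Matrix.orthogonalGroup (Fin d) ℝ) :
    Continuous fun W : Matrix (Fin k) (Fin d) ℝ => W * (Q : Matrix (Fin d) (Fin d) ℝ) :=
  Continuous.matrix_mul continuous_id continuous_const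

/-- The law of `W` is invariant under rotations of the input space. -/
lemma map_mul_randomRotationProjection (Q : Matrix.orthogonalGroup (Fin d) ℝ) :
    (randomRotationProjection k d).map (fun W => W * (Q : Matrix (Fin d) (Fin d) ℝ)) =
      randomRotationProjection k d := by
  have hQ := (continuous_mul_orthogonal (k := k) Q).measurable
  rw [randomRotationProjection_eq, Measure.map_smul, Measure.map_finset_sum hQ.aemeasurable]
  congr 1
  refine Finset.sum_congr rfl fun f _ => ?_
  have hf := (continuous_sampledRotation f).measurable
  rw [Measure.map_map hQ hf]
  have e : (fun W : Matrix (Fin k) (Fin d) ℝ => W * (Q : Matrix (Fin d) (Fin d) ℝ)) ∘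
      sampledRotation f = sampledRotation f ∘ (· * Q) := by
    ext1 U
    exact (sampledRotation_mul f U Q).symm
  rw [e, ← Measure.map_map hf (measurable_mul_const Q), map_mul_right_eq_self]

lemma ae_mul_transpose_randomRotationProjection :
    ∀ᵐ W ∂(randomRotationProjection k d), W * Wᵀ = ((d : ℝ) / k) • 1 :=
  ae_randomRotationProjection
    (isClosed_eq (Continuous.matrix_mul continuous_id continuous_id.matrix_transpose)
      continuous_const).measurableSet
    fun f => ae_of_all _ fun U => sampledRotation_mul_transpose f U

lemma ae_randomRotationProjection_ne_zero (hk : 1 ≤ k) {v : EuclideanSpace ℝ (Fin d)}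
    (hv : ‖v‖ = 1) (hd : 1 ≤ d) :
    ∀ᵐ W ∂(randomRotationProjection k d), Matrix.toEuclideanLin W v ≠ 0 := by
  refine ae_randomRotationProjection
    (isOpen_ne_fun (continuous_toEuclideanLin v) continuous_const).measurableSet fun f => ?_
  refine (ae_rotationCoord_ne_zero hv (f ⟨0, hk⟩)).mono fun U hU h0 => hU ?_
  have h := sampledRotation_coord f U v ⟨0, hk⟩
  rw [h0, PiLp.zero_apply] at h
  have hs : Real.sqrt ((d : ℝ) / k) ≠ 0 := by
    have : (0 : ℝ) < d := by exact_mod_cast hd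
    have : (0 : ℝ) < k := by exact_mod_cast hk
    positivity
  exact (mul_eq_zero.1 h.symm).resolve_left hs

lemma integral_norm_randomRotationProjection_sq (hk : 1 ≤ k) (hkd : k ≤ d)
    {v : EuclideanSpace ℝ (Fin d)} (hv : ‖v‖ = 1) :
    ∫ W, ‖Matrix.toEuclideanLin W v‖ ^ 2 ∂(randomRotationProjection k d) = 1 := by
  have hI : ∀ j, Integrable (fun U => rotationCoord v j U ^ 2) (uniformRotation d) := fun j =>
    integrable_uniformRotation (by fun_prop)
  refine integral_randomRotationProjection_of_forall hkd
    (g := fun W => ‖Matrix.toEuclideanLin W v‖ ^ 2)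
    ((continuous_toEuclideanLin v).norm.pow 2) fun f => ?_
  simp_rw [norm_sampledRotation_sq]
  rw [integral_const_mul, integral_finsetSum _ fun i _ => hI (f i)]
  have hd : (d : ℝ) ≠ 0 := by
    have : d ≠ 0 := by omega
    exact_mod_cast this
  have hk : (k : ℝ) ≠ 0 := by positivity
  simp only [integral_rotationCoord_sq hv, Finset.sum_const, Finset.card_univ,
    Fintype.card_fin, nsmul_eq_mul]
  field_simp

lemma integral_norm_randomRotationProjection_pow_four_le (hk : 1 ≤ k) (hkd : k ≤ d)
    {v : EuclideanSpace ℝ (Fin d)} (hv : ‖v‖ = 1) :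
    ∫ W, (‖Matrix.toEuclideanLin W v‖ ^ 2) ^ 2 ∂(randomRotationProjection k d) ≤ 1 + 2 / k := by
  have hd : (0 : ℝ) < d := by have : 0 < d := by omega
                              exact_mod_cast this
  have hk0 : (0 : ℝ) < k := by exact_mod_cast hk
  have h : ∫ W, (‖Matrix.toEuclideanLin W v‖ ^ 2) ^ 2 ∂(randomRotationProjection k d) =
      ((d : ℝ) / k) ^ 2 * ((k * (k + 2)) / (d * (d + 2))) := by
    refine integral_randomRotationProjection_of_forall hkd
      (g := fun W => (‖Matrix.toEuclideanLin W v‖ ^ 2) ^ 2)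
      (((continuous_toEuclideanLin v).norm.pow 2).pow 2) fun f => ?_
    simp_rw [norm_sampledRotation_sq, mul_pow]
    rw [integral_const_mul, integral_sampled_sq_sq hk hkd f hv]
  rw [h]
  have e : ((d : ℝ) / k) ^ 2 * ((k * (k + 2)) / (d * (d + 2))) = (1 + 2 / k) * (d / (d + 2)) := by
    field_simp
  rw [e]
  exact mul_le_of_le_one_right (by positivity) ((div_le_one (by linarith)).2 (by linarith))

/-- The expected norm of `W v` lies in `[1 - 1 / k, 1]`: the squared norm has mean one and variance
at most `2 / k`, and `√x ≥ 1 + (x - 1) / 2 - (x - 1)² / 2`. -/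
lemma integral_norm_randomRotationProjection_mem (hk : 1 ≤ k) (hkd : k ≤ d)
    {v : EuclideanSpace ℝ (Fin d)} (hv : ‖v‖ = 1) :
    ∫ W, ‖Matrix.toEuclideanLin W v‖ ∂(randomRotationProjection k d) ∈
      Set.Icc (1 - 1 / (k : ℝ)) 1 := by
  have := isProbabilityMeasure_randomRotationProjection hkd
  have hc := (continuous_toEuclideanLin (k := k) v).norm
  have h1 := integrable_randomRotationProjection hkd hc
  have h2 : Integrable (fun W => ‖Matrix.toEuclideanLin W v‖ ^ 2)
    (randomRotationProjection k d) := integrable_randomRotationProjection hkd (hc.pow 2)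
  have h4 : Integrable (fun W => (‖Matrix.toEuclideanLin W v‖ ^ 2) ^ 2)
    (randomRotationProjection k d) := integrable_randomRotationProjection hkd ((hc.pow 2).pow 2)
  have e2 := integral_norm_randomRotationProjection_sq hk hkd hv
  have e4 := integral_norm_randomRotationProjection_pow_four_le hk hkd hv
  constructor
  · have hlow : ∫ W, (3 / 2 * ‖Matrix.toEuclideanLin W v‖ ^ 2 -
        1 / 2 * (‖Matrix.toEuclideanLin W v‖ ^ 2) ^ 2) ∂(randomRotationProjection k d) ≤
        ∫ W, ‖Matrix.toEuclideanLin W v‖ ∂(randomRotationProjection k d) := by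
      refine integral_mono ((h2.const_mul _).sub (h4.const_mul _)) h1 fun W => ?_
      have hy := norm_nonneg (Matrix.toEuclideanLin W v)
      dsimp only
      set y := ‖Matrix.toEuclideanLin W v‖
      nlinarith [mul_nonneg hy (mul_nonneg (sq_nonneg (y - 1)) (by linarith : 0 ≤ y + 2))]
    rw [integral_sub (h2.const_mul _) (h4.const_mul _), integral_const_mul, integral_const_mul,
      e2] at hlow
    have : 1 / (k : ℝ) = 1 / 2 * (2 / k) := by ring
    linarith
  · have hup : ∫ W, ‖Matrix.toEuclideanLin W v‖ ∂(randomRotationProjection k d) ≤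
        ∫ W, (1 / 2 + 1 / 2 * ‖Matrix.toEuclideanLin W v‖ ^ 2)
          ∂(randomRotationProjection k d) := by
      refine integral_mono h1 ((integrable_const _).add (h2.const_mul _)) fun W => ?_
      dsimp only
      nlinarith [sq_nonneg (‖Matrix.toEuclideanLin W v‖ - 1)]
    rw [integral_add (integrable_const _) (h2.const_mul _), integral_const_mul, e2] at hup
    norm_num at hup
    exact hup

lemma norm_toEuclideanLin_transpose_sq {W : Matrix (Fin k) (Fin d) ℝ} {c : ℝ}
    (hW : W * Wᵀ = c • 1) (y : EuclideanSpace ℝ (Fin k)) :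
    ‖Matrix.toEuclideanLin Wᵀ y‖ ^ 2 = c * ‖y‖ ^ 2 := by
  rw [← real_inner_self_eq_norm_sq, inner_toEuclideanLin, Matrix.transpose_transpose,
    ← toEuclideanLin_mul, hW, map_smul, LinearMap.smul_apply, toEuclideanLin_one,
    inner_smul_left, real_inner_self_eq_norm_sq]
  rfl

/-- The normalized projection `u = W v / ‖W v‖`. -/
noncomputable def projUnit (v : EuclideanSpace ℝ (Fin d)) (W : Matrix (Fin k) (Fin d) ℝ) :
    EuclideanSpace ℝ (Fin k) :=
  ‖Matrix.toEuclideanLin W v‖⁻¹ • Matrix.toEuclideanLin W v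

lemma norm_projUnit {v : EuclideanSpace ℝ (Fin d)} {W : Matrix (Fin k) (Fin d) ℝ}
    (h : Matrix.toEuclideanLin W v ≠ 0) : ‖projUnit v W‖ = 1 := by
  rw [projUnit, norm_smul, norm_inv, norm_norm, inv_mul_cancel₀ (norm_ne_zero_iff.2 h)]

lemma measurable_projUnit (v : EuclideanSpace ℝ (Fin d)) :
    Measurable (projUnit (k := k) v) := by
  have := (continuous_toEuclideanLin (k := k) v).measurable
  exact this.norm.inv.smul this

lemma continuous_uncurry_transpose :
    Continuous fun x : EuclideanSpace ℝ (Fin k) × Matrix (Fin k) (Fin d) ℝ =>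
      Matrix.toEuclideanLin x.2ᵀ x.1 :=
  continuous_uncurry_toEuclideanLin.comp (continuous_snd.matrix_transpose.prodMk continuous_fst)

lemma inner_transpose_projUnit (v : EuclideanSpace ℝ (Fin d)) (W : Matrix (Fin k) (Fin d) ℝ) :
    ⟪v, Matrix.toEuclideanLin Wᵀ (projUnit v W)⟫_ℝ = ‖Matrix.toEuclideanLin W v‖ := by
  rw [inner_toEuclideanLin, Matrix.transpose_transpose, projUnit, inner_smul_right,
    real_inner_self_eq_norm_sq, sq]
  by_cases h : ‖Matrix.toEuclideanLin W v‖ = 0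
  · simp [h]
  · rw [← mul_assoc, inv_mul_cancel₀ h, one_mul]

lemma measurable_transpose_projUnit (v : EuclideanSpace ℝ (Fin d)) :
    Measurable fun W : Matrix (Fin k) (Fin d) ℝ => Matrix.toEuclideanLin Wᵀ (projUnit v W) :=
  Measurable.comp (f := fun W : Matrix (Fin k) (Fin d) ℝ => (projUnit v W, W))
    continuous_uncurry_transpose.measurable ((measurable_projUnit v).prodMk measurable_id)

lemma integrable_transpose_projUnit (hk : 1 ≤ k) (hkd : k ≤ d) {v : EuclideanSpace ℝ (Fin d)}
    (hv : ‖v‖ = 1) :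
    Integrable (fun W => Matrix.toEuclideanLin Wᵀ (projUnit v W))
      (randomRotationProjection k d) := by
  have := isProbabilityMeasure_randomRotationProjection hkd
  refine Integrable.of_bound (C := Real.sqrt ((d : ℝ) / k)) ?_ ?_
  · exact (measurable_transpose_projUnit v).aestronglyMeasurable
  · filter_upwards [ae_mul_transpose_randomRotationProjection,
      ae_randomRotationProjection_ne_zero hk hv (hk.trans hkd)] with W hW h0
    refine Real.le_sqrt_of_sq_le ?_
    rw [norm_toEuclideanLin_transpose_sq hW, norm_projUnit h0]
    simp

lemma transpose_projUnit_mul {Q : Matrix.orthogonalGroup (Fin d) ℝ}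
    {v : EuclideanSpace ℝ (Fin d)}
    (hQ : Matrix.toEuclideanLin (Q : Matrix (Fin d) (Fin d) ℝ) v = v)
    (W : Matrix (Fin k) (Fin d) ℝ) :
    Matrix.toEuclideanLin (W * (Q : Matrix (Fin d) (Fin d) ℝ))ᵀ
        (projUnit v (W * (Q : Matrix (Fin d) (Fin d) ℝ))) =
      Matrix.toEuclideanLin (Q : Matrix (Fin d) (Fin d) ℝ)ᵀ
        (Matrix.toEuclideanLin Wᵀ (projUnit v W)) := by
  rw [Matrix.transpose_mul, toEuclideanLin_mul, projUnit, toEuclideanLin_mul, hQ, projUnit]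

/-- The expected reconstruction is invariant under the rotations that fix `v`, because the law of
`W` is. -/
lemma transpose_integral_transpose_projUnit (hk : 1 ≤ k) (hkd : k ≤ d)
    {v : EuclideanSpace ℝ (Fin d)} (hv : ‖v‖ = 1) {Q : Matrix.orthogonalGroup (Fin d) ℝ}
    (hQ : Matrix.toEuclideanLin (Q : Matrix (Fin d) (Fin d) ℝ) v = v) :
    Matrix.toEuclideanLin (Q : Matrix (Fin d) (Fin d) ℝ)ᵀ
        (∫ W, Matrix.toEuclideanLin Wᵀ (projUnit v W) ∂(randomRotationProjection k d)) =
      ∫ W, Matrix.toEuclideanLin Wᵀ (projUnit v W) ∂(randomRotationProjection k d) := by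
  have h1 := integral_map (μ := randomRotationProjection k d)
    (continuous_mul_orthogonal Q).aemeasurable
    (measurable_transpose_projUnit (k := k) v).aestronglyMeasurable
  rw [map_mul_randomRotationProjection] at h1
  have h2 := (LinearMap.toContinuousLinearMap (Matrix.toEuclideanLin
    (Q : Matrix (Fin d) (Fin d) ℝ)ᵀ)).integral_comp_comm (integrable_transpose_projUnit hk hkd hv)
  have h3 : ∫ W, Matrix.toEuclideanLin (W * (Q : Matrix (Fin d) (Fin d) ℝ))ᵀ
      (projUnit v (W * (Q : Matrix (Fin d) (Fin d) ℝ))) ∂(randomRotationProjection k d) =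
      ∫ W, Matrix.toEuclideanLin (Q : Matrix (Fin d) (Fin d) ℝ)ᵀ
        (Matrix.toEuclideanLin Wᵀ (projUnit v W)) ∂(randomRotationProjection k d) :=
    integral_congr_ae (ae_of_all _ fun W => transpose_projUnit_mul hQ W)
  exact h2.symm.trans (h3.symm.trans h1.symm)

/-- Reconstructing from the normalized projection recovers `v` up to the factor `𝔼 ‖W v‖`: the
expectation is fixed by the reflection across the line of `v`. -/
lemma integral_transpose_projUnit (hk : 1 ≤ k) (hkd : k ≤ d) {v : EuclideanSpace ℝ (Fin d)}
    (hv : ‖v‖ = 1) :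
    ∫ W, Matrix.toEuclideanLin Wᵀ (projUnit v W) ∂(randomRotationProjection k d) =
      (∫ W, ‖Matrix.toEuclideanLin W v‖ ∂(randomRotationProjection k d)) • v := by
  obtain ⟨Q, hQ⟩ := exists_orthogonal_of_linearIsometryEquiv (ℝ ∙ v).reflection
  have hQv : Matrix.toEuclideanLin (Q : Matrix (Fin d) (Fin d) ℝ) v = v :=
    (hQ v).trans (Submodule.reflection_mem_subspace_eq_self (Submodule.mem_span_singleton_self v))
  have hvb : ⟪v, ∫ W, Matrix.toEuclideanLin Wᵀ (projUnit v W) ∂(randomRotationProjection k d)⟫_ℝ =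
      ∫ W, ‖Matrix.toEuclideanLin W v‖ ∂(randomRotationProjection k d) := by
    rw [← integral_inner (integrable_transpose_projUnit hk hkd hv) v]
    simp_rw [inner_transpose_projUnit]
  have hinv := transpose_integral_transpose_projUnit hk hkd hv hQv
  generalize ∫ W, Matrix.toEuclideanLin Wᵀ (projUnit v W) ∂(randomRotationProjection k d) = b
    at hvb hinv ⊢
  have hfix : (ℝ ∙ v).reflection b = b := by
    conv_lhs => rw [← hinv]
    rw [← hQ, ← toEuclideanLin_mul, mul_transpose_self_orthogonal, toEuclideanLin_one]
  rw [← hvb]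
  rw [Submodule.reflection_singleton_apply, hv, sub_eq_iff_eq_add, ← two_smul ℝ b,
    ← Nat.cast_smul_eq_nsmul ℝ, Nat.cast_ofNat] at hfix
  have h2 := smul_right_injective (EuclideanSpace ℝ (Fin d)) (two_ne_zero (α := ℝ)) hfix
  rw [← h2]
  simp [inner_smul_right, hv]

end Projection

/-! ### The client of the random rotation protocol -/

section Client

variable {k d : ℕ}

/-- The message `(û, W)` as a function of `W` and of the randomness of PrivUnitG. -/
noncomputable def projMessage (p q : ℝ) (v : EuclideanSpace ℝ (Fin d))
    (x : Matrix (Fin k) (Fin d) ℝ × (ℝ × EuclideanSpace ℝ (Fin k))) :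
    EuclideanSpace ℝ (Fin k) × Matrix (Fin k) (Fin d) ℝ :=
  (pugOutput p q (projUnit v x.1) x.2, x.1)

lemma projUnitClient_eq (μW : Measure (Matrix (Fin k) (Fin d) ℝ)) (p q : ℝ)
    (v : EuclideanSpace ℝ (Fin d)) :
    projUnitClient μW p q v = (μW.prod (pugNoise k p q)).map (projMessage p q v) := rfl

lemma measurable_projMessage (p q : ℝ) (v : EuclideanSpace ℝ (Fin d)) :
    Measurable (projMessage (k := k) p q v) := by
  refine Measurable.prodMk ?_ measurable_fst
  exact Measurable.comp (f := fun x : Matrix (Fin k) (Fin d) ℝ × (ℝ × EuclideanSpace ℝ (Fin k)) =>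
      (projUnit v x.1, x.2))
    (continuous_uncurry_pugOutput p q).measurable
    (((measurable_projUnit v).comp measurable_fst).prodMk measurable_snd)

/-- Given `W`, the message is a private function of the input; publishing `W` is harmless because
its law does not depend on the input. -/
lemma isLocallyDP_projUnitClient (hk : 1 ≤ k) (hkd : k ≤ d) {ε p t : ℝ}
    (hp : p ∈ Set.Icc (0 : ℝ) 1)
    (h : IsLocallyDP ε (privUnitG k p (cdf (gaussianReal 0 1) t))) :
    IsLocallyDP ε
      (projUnitClient (randomRotationProjection k d) p (cdf (gaussianReal 0 1) t)) := by
  have := isProbabilityMeasure_randomRotationProjection hkd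
  have := isProbabilityMeasure_pugNoise hk hp t
  intro v v' hv hv' S hS
  have hsec : ∀ (w : EuclideanSpace ℝ (Fin d)),
      projUnitClient (randomRotationProjection k d) p (cdf (gaussianReal 0 1) t) w S =
      ∫⁻ W, privUnitG k p (cdf (gaussianReal 0 1) t) (projUnit w W) {y | (y, W) ∈ S}
        ∂(randomRotationProjection k d) := by
    intro w
    rw [projUnitClient_eq, Measure.map_apply (measurable_projMessage _ _ _) hS,
      Measure.prod_apply (measurable_projMessage _ _ _ hS)]
    refine lintegral_congr fun W => ?_
    have hSW : MeasurableSet {y : EuclideanSpace ℝ (Fin k) | (y, W) ∈ S} :=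
      (measurable_id.prodMk measurable_const) hS
    rw [privUnitG, Measure.map_apply (measurable_pugOutput _ _ _) hSW]
    rfl
  rw [hsec, hsec]
  rw [← lintegral_const_mul' _ _ ENNReal.ofReal_ne_top]
  refine lintegral_mono_ae ?_
  filter_upwards [ae_randomRotationProjection_ne_zero hk hv (hk.trans hkd),
    ae_randomRotationProjection_ne_zero hk hv' (hk.trans hkd)] with W h1 h2
  exact h _ _ (norm_projUnit h1) (norm_projUnit h2) _ ((measurable_id.prodMk measurable_const) hS)

/-- The contribution `Wᵀ û` of a message to the estimate of the server. -/
noncomputable def projDecode (y : EuclideanSpace ℝ (Fin k) × Matrix (Fin k) (Fin d) ℝ) :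
    EuclideanSpace ℝ (Fin d) :=
  Matrix.toEuclideanLin y.2ᵀ y.1

lemma measurable_projDecode : Measurable (projDecode (k := k) (d := d)) :=
  continuous_uncurry_transpose.measurable

lemma measurable_projDecode_projMessage (p q : ℝ) (v : EuclideanSpace ℝ (Fin d)) :
    Measurable fun x => projDecode (projMessage (k := k) p q v x) :=
  measurable_projDecode.comp (measurable_projMessage p q v)

lemma norm_projDecode_sq {W : Matrix (Fin k) (Fin d) ℝ} {c : ℝ} (hW : W * Wᵀ = c • 1) (p q : ℝ)
    (v : EuclideanSpace ℝ (Fin d)) (ω : ℝ × EuclideanSpace ℝ (Fin k)) :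
    ‖projDecode (projMessage p q v (W, ω))‖ ^ 2 = c * ‖pugOutput p q (projUnit v W) ω‖ ^ 2 :=
  norm_toEuclideanLin_transpose_sq hW _

/-- The conditional second moment of `Wᵀ û` given `W` is almost surely constant. -/
lemma ae_integral_norm_projDecode_sq (hk : 1 ≤ k) (hkd : k ≤ d) {p : ℝ}
    (hp : p ∈ Set.Icc (0 : ℝ) 1) {t : ℝ} (hM : pugMean t p ≠ 0) {v : EuclideanSpace ℝ (Fin d)}
    (hv : ‖v‖ = 1) :
    ∀ᵐ W ∂(randomRotationProjection k d),
      Integrable (fun ω => ‖projDecode (projMessage p (cdf (gaussianReal 0 1) t) v (W, ω))‖ ^ 2)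
        (pugNoise k p (cdf (gaussianReal 0 1) t)) ∧
      ∫ ω, ‖projDecode (projMessage p (cdf (gaussianReal 0 1) t) v (W, ω))‖ ^ 2
        ∂(pugNoise k p (cdf (gaussianReal 0 1) t)) =
        (d : ℝ) / k * (pugLoss k t p + 1) := by
  filter_upwards [ae_mul_transpose_randomRotationProjection,
    ae_randomRotationProjection_ne_zero hk hv (hk.trans hkd)] with W hW h0
  have hu := norm_projUnit h0
  simp only [norm_projDecode_sq hW]
  refine ⟨(integrable_norm_pugOutput_sq hk hp t hu).const_mul _, ?_⟩
  rw [integral_const_mul, integral_norm_pugOutput_sq hk hp hM hu, pugLoss, sub_add_cancel]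

lemma integrable_norm_projDecode_sq (hk : 1 ≤ k) (hkd : k ≤ d) {p : ℝ}
    (hp : p ∈ Set.Icc (0 : ℝ) 1) {t : ℝ} (hM : pugMean t p ≠ 0) {v : EuclideanSpace ℝ (Fin d)}
    (hv : ‖v‖ = 1) :
    Integrable (fun x => ‖projDecode (projMessage p (cdf (gaussianReal 0 1) t) v x)‖ ^ 2)
      ((randomRotationProjection k d).prod (pugNoise k p (cdf (gaussianReal 0 1) t))) := by
  have := isProbabilityMeasure_randomRotationProjection hkd
  have := isProbabilityMeasure_pugNoise hk hp t
  have hae := ae_integral_norm_projDecode_sq hk hkd hp hM hv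
  refine (integrable_prod_iff
    ((measurable_projDecode_projMessage _ _ v).norm.pow_const 2).aestronglyMeasurable).2 ⟨?_, ?_⟩
  · exact hae.mono fun W hW => hW.1
  · refine (integrable_const ((d : ℝ) / k * (pugLoss k t p + 1))).congr ?_
    filter_upwards [hae] with W hW
    simp only [norm_pow, norm_norm]
    exact hW.2.symm

lemma integral_norm_projDecode_sq (hk : 1 ≤ k) (hkd : k ≤ d) {p : ℝ}
    (hp : p ∈ Set.Icc (0 : ℝ) 1) {t : ℝ} (hM : pugMean t p ≠ 0) {v : EuclideanSpace ℝ (Fin d)}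
    (hv : ‖v‖ = 1) :
    ∫ x, ‖projDecode (projMessage p (cdf (gaussianReal 0 1) t) v x)‖ ^ 2
      ∂((randomRotationProjection k d).prod (pugNoise k p (cdf (gaussianReal 0 1) t))) =
      (d : ℝ) / k * (pugLoss k t p + 1) := by
  have := isProbabilityMeasure_randomRotationProjection hkd
  have := isProbabilityMeasure_pugNoise hk hp t
  have hae := ae_integral_norm_projDecode_sq hk hkd hp hM hv
  rw [integral_prod _ (integrable_norm_projDecode_sq hk hkd hp hM hv),
    integral_congr_ae (hae.mono fun W hW => hW.2)]
  simp

lemma memLp_projDecode (hk : 1 ≤ k) (hkd : k ≤ d) {p : ℝ}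
    (hp : p ∈ Set.Icc (0 : ℝ) 1) {t : ℝ} (hM : pugMean t p ≠ 0) {v : EuclideanSpace ℝ (Fin d)}
    (hv : ‖v‖ = 1) :
    MemLp (fun x => projDecode (projMessage p (cdf (gaussianReal 0 1) t) v x)) 2
      ((randomRotationProjection k d).prod (pugNoise k p (cdf (gaussianReal 0 1) t))) :=
  (memLp_two_iff_integrable_sq_norm
    (measurable_projDecode_projMessage _ _ v).aestronglyMeasurable).2
    (integrable_norm_projDecode_sq hk hkd hp hM hv)

lemma integral_projDecode_of_matrix (hk : 1 ≤ k) {p : ℝ}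
    (hp : p ∈ Set.Icc (0 : ℝ) 1) {t : ℝ} (hM : pugMean t p ≠ 0) (v : EuclideanSpace ℝ (Fin d))
    (W : Matrix (Fin k) (Fin d) ℝ) :
    ∫ ω, projDecode (projMessage p (cdf (gaussianReal 0 1) t) v (W, ω))
      ∂(pugNoise k p (cdf (gaussianReal 0 1) t)) =
      Matrix.toEuclideanLin Wᵀ (projUnit v W) := by
  have h := (LinearMap.toContinuousLinearMap (Matrix.toEuclideanLin Wᵀ)).integral_comp_comm
    (integrable_pugOutput hk hp t (projUnit v W))
  rw [integral_pugOutput hk hp hM] at h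
  exact h

lemma integral_projDecode (hk : 1 ≤ k) (hkd : k ≤ d) {p : ℝ}
    (hp : p ∈ Set.Icc (0 : ℝ) 1) {t : ℝ} (hM : pugMean t p ≠ 0) {v : EuclideanSpace ℝ (Fin d)}
    (hv : ‖v‖ = 1) :
    ∫ x, projDecode (projMessage p (cdf (gaussianReal 0 1) t) v x)
      ∂((randomRotationProjection k d).prod (pugNoise k p (cdf (gaussianReal 0 1) t))) =
      (∫ W, ‖Matrix.toEuclideanLin W v‖ ∂(randomRotationProjection k d)) • v := by
  have := isProbabilityMeasure_randomRotationProjection hkd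
  have := isProbabilityMeasure_pugNoise hk hp t
  rw [integral_prod _ ((memLp_projDecode hk hkd hp hM hv).integrable one_le_two)]
  simp_rw [integral_projDecode_of_matrix hk hp hM]
  exact integral_transpose_projUnit hk hkd hv

end Client

/-! ### The error of the random rotation protocol -/

/-- The bias and the variance of the protocol: `W_iᵀ û_i` has mean `c_i v_i` with
`1 - 1 / k ≤ c_i ≤ 1`, and a second moment that does not depend on `v_i`. -/
lemma meanSquaredError_projUnitServer_le {n k d : ℕ} (hk : 1 ≤ k) (hkd : k ≤ d)
    {p : ℝ} (hp : p ∈ Set.Icc (0 : ℝ) 1) {t : ℝ} (hM : pugMean t p ≠ 0)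
    {v : Fin n → EuclideanSpace ℝ (Fin d)} (hv : ∀ i, ‖v i‖ = 1) {B : ℝ}
    (hB : ∀ c : ℝ, 1 - 1 / (k : ℝ) ≤ c → (d : ℝ) / k * (pugLoss k t p + 1) - c ^ 2 ≤ B) :
    meanSquaredError projUnitServer
        (projUnitClient (randomRotationProjection k d) p (cdf (gaussianReal 0 1) t)) v ≤
      ENNReal.ofReal ((1 / (n : ℝ)) ^ 2 * (n * B) + (1 / (k : ℝ)) ^ 2) := by
  have := isProbabilityMeasure_randomRotationProjection hkd
  have := isProbabilityMeasure_pugNoise hk hp t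
  set q := cdf (gaussianReal 0 1) t with hq
  set c : Fin n → ℝ := fun i =>
    ∫ W, ‖Matrix.toEuclideanLin W (v i)‖ ∂(randomRotationProjection k d) with hc
  have hcmem : ∀ i, c i ∈ Set.Icc (1 - 1 / (k : ℝ)) 1 := fun i =>
    integral_norm_randomRotationProjection_mem hk hkd (hv i)
  have hmsg := fun i => (measurable_projMessage (k := k) p q (v i)).aemeasurable
    (μ := (randomRotationProjection k d).prod (pugNoise k p q))
  have hprob : ∀ i, IsProbabilityMeasure
      (projUnitClient (randomRotationProjection k d) p q (v i)) := fun i => by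
    rw [projUnitClient_eq]
    exact Measure.isProbabilityMeasure_map (hmsg i)
  have hmem : ∀ i, MemLp projDecode 2
      (projUnitClient (randomRotationProjection k d) p q (v i)) := fun i => by
    rw [projUnitClient_eq]
    exact (memLp_map_measure_iff measurable_projDecode.aestronglyMeasurable (hmsg i)).2
      (memLp_projDecode hk hkd hp hM (hv i))
  have h1 : ∀ i, ∫ y, projDecode y ∂(projUnitClient (randomRotationProjection k d) p q (v i)) =
      c i • v i := fun i => by
    rw [projUnitClient_eq, integral_map (hmsg i) measurable_projDecode.aestronglyMeasurable,
      integral_projDecode hk hkd hp hM (hv i)]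
  have h2 : ∀ i, ∫ y, ‖projDecode y‖ ^ 2
      ∂(projUnitClient (randomRotationProjection k d) p q (v i)) =
      (d : ℝ) / k * (pugLoss k t p + 1) := fun i => by
    rw [projUnitClient_eq, integral_map (hmsg i)
      (measurable_projDecode.norm.pow_const 2).aestronglyMeasurable,
      integral_norm_projDecode_sq hk hkd hp hM (hv i)]
  have hmse := lintegral_pi_average_error
    (fun i => projUnitClient (randomRotationProjection k d) p q (v i)) hmem
    ((1 / (n : ℝ)) • ∑ i, v i)
  refine (Eq.le hmse).trans (ENNReal.ofReal_le_ofReal ?_)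
  simp only [h1, h2, norm_smul, hv, mul_one, Real.norm_eq_abs, sq_abs]
  have hvar : ∑ i, ((d : ℝ) / k * (pugLoss k t p + 1) - c i ^ 2) ≤ n * B := by
    refine (Finset.sum_le_sum fun i _ => hB (c i) (hcmem i).1).trans ?_
    simp
  have hbias : ‖(1 / (n : ℝ)) • ∑ i, c i • v i - (1 / (n : ℝ)) • ∑ i, v i‖ ≤ 1 / k := by
    rw [← smul_sub, ← Finset.sum_sub_distrib, norm_smul]
    have hterm : ∀ i, ‖c i • v i - v i‖ ≤ 1 / k := fun i => by
      have e : c i • v i - v i = (c i - 1) • v i := by rw [sub_smul, one_smul]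
      rw [e, norm_smul, hv, mul_one, Real.norm_eq_abs, abs_le]
      have := hcmem i
      have hk' : (0 : ℝ) ≤ 1 / k := by positivity
      exact ⟨by linarith [this.1], by linarith [this.2]⟩
    have hsum : ‖∑ i, (c i • v i - v i)‖ ≤ n * (1 / k) := by
      refine (norm_sum_le_of_le _ fun i _ => hterm i).trans ?_
      simp
    refine (mul_le_mul_of_nonneg_left hsum (norm_nonneg _)).trans ?_
    rw [Real.norm_of_nonneg (by positivity), ← mul_assoc]
    refine mul_le_of_le_one_left (by positivity) ?_
    rw [one_div]
    exact inv_mul_le_one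
  gcongr

theorem mainTheorem4 :
    (∀ ε : ℝ, 0 < ε → ∀ d : ℕ, 1 ≤ d → ∃ p q : ℝ, PugOptimal ε d p q ∧
      ∀ n : ℕ, 1 ≤ n → pugError n d p q < ⊤) ∧
    ∃ C : ℝ, 0 < C ∧ ∀ ε : ℝ, 0 < ε → ∀ n k d : ℕ, 1 ≤ n → 1 ≤ k → k ≤ d →
      ∀ p q : ℝ, PugOptimal ε k p q → ∀ p₀ q₀ : ℝ, PugOptimal ε d p₀ q₀ →
        IsLocallyDP ε (projUnitClient (randomRotationProjection k d) p q) ∧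
        ∀ v : Fin n → EuclideanSpace ℝ (Fin d), (∀ i, ‖v i‖ = 1) →
          meanSquaredError projUnitServer
              (projUnitClient (randomRotationProjection k d) p q) v ≤
            pugError n d p₀ q₀ * ENNReal.ofReal (1 + C * ((ε + Real.log k) / k)) +
              ENNReal.ofReal (C / (k : ℝ) ^ 2) := by
  refine ⟨fun ε hε d hd => exists_pugOptimal hε hd, 2120, by norm_num, ?_⟩
  intro ε hε n k d hn hk hkd p q hopt p₀ q₀ hopt₀
  have hd := hk.trans hkd
  obtain ⟨t, rfl⟩ := hopt.1.exists_cdf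
  obtain ⟨t₀, rfl⟩ := hopt₀.1.exists_cdf
  obtain ⟨hp, hM, -⟩ := (pugAdmissible_cdf_iff hε.le hk).1 hopt.1
  obtain ⟨hp₀, hM₀, hr₀⟩ := (pugAdmissible_cdf_iff hε.le hd).1 hopt₀.1
  refine ⟨isLocallyDP_projUnitClient hk hkd hp hopt.1.private_pug, fun v hv => ?_⟩
  -- The parameters of the benchmark are admissible for the clients, since privacy does not depend
  -- on the dimension.
  have hloss := hopt.pugLoss_le hε hk hp₀ hM₀ hr₀
  have hL₀ := pugLoss_nonneg hd hp₀ hM₀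
  have hlog : 0 ≤ Real.log k := Real.log_nonneg (by exact_mod_cast hk)
  have hn1 : (1 : ℝ) ≤ n := by exact_mod_cast hn
  refine (meanSquaredError_projUnitServer_le hk hkd hp hM hv (B := pugLoss d t₀ p₀ *
    (1 + 2120 * ((ε + Real.log k) / k)) + 1 / (k : ℝ) ^ 2) fun c hc => ?_).trans ?_
  · refine le_trans ?_ (variance_le_pugLoss hε hk hkd hp₀ hM₀ hr₀ hc)
    gcongr
  · have hn0 : 0 < (n : ℝ) := by linarith
    have hk0 : 0 < (k : ℝ) := by exact_mod_cast hk
    rw [pugError_eq hn hd hp₀ hM₀, ← ENNReal.ofReal_mul (by positivity),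
      ← ENNReal.ofReal_add (by positivity) (by positivity)]
    refine ENNReal.ofReal_le_ofReal ?_
    have e : (1 / (n : ℝ)) ^ 2 * (n * (pugLoss d t₀ p₀ *
        (1 + 2120 * ((ε + Real.log k) / k)) + 1 / (k : ℝ) ^ 2)) + (1 / (k : ℝ)) ^ 2 =
        pugLoss d t₀ p₀ / n * (1 + 2120 * ((ε + Real.log k) / k)) +
          (1 / n + 1) * (1 / (k : ℝ) ^ 2) := by
      field_simp
      ring
    have h1n : 1 / (n : ℝ) ≤ 1 := (div_le_one hn0).2 hn1
    rw [e, div_eq_mul_one_div (2120 : ℝ)]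
    gcongr
    linarith
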